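/- Let $X_\Delta=(X_\Delta(t),\,t\in\mathbb R)$, $\Delta>0$, be stationary centered real Gaussian processes on a probability space $(\Omega,\mathfrak F,P)$, with nonnegative continuous spectral densities $f_\Delta$ and correlation functions $$K_\Delta(t)=\mathsf E X_\Delta(s+t)X_\Delta(s)=\int_{-\infty}^{\infty}e^{i\lambda t}f_\Delta(\lambda)\,d\lambda .$$ Assume that each $f_\Delta$ is even, that $\sup_{\Delta>0}\|f_\Delta\|_\infty<\infty$, that $f_\Delta\in L_1(\mathbb R)$ and $K_\Delta\in L_1(\mathbb R)$ for every $\Delta>0$, and that for some $c\in(0,\infty)$ $$\lim_{\Delta\to\infty}\ \sup_{-a\le\lambda\le a}\Big|f_\Delta(\lambda)-\frac{c}{2\pi}\Big|=0\qquad\text{for all } a>0 .$$ Let $\alpha\in(0,1]$ and suppose that (a) $\lim_{\Delta\to\infty}\int_\delta^\infty K_\Delta(t)\,dt=0$ for every $\delta>0$; (b) $\lim_{\Delta\to\infty}\int_\delta^\infty K_\Delta^2(t)\,dt=0$ for every $\delta>0$; (c) $\lim_{\Delta\to\infty}\int_{-\delta}^{\delta}|K_\Delta(t)|\,|t|^\alpha\,dt=0$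 for some $\delta>0$. Let $H\in L_2(\mathbb R)$ be real-valued and belong to $Lip_\alpha(\mathbb R)$, that is, there are $\delta>0$ and $M>0$ such that $|H(t)-H(s)|\le M|t-s|^\alpha$ for all $t,s\in\mathbb R$ with $|t-s|<\delta$. Put $$Y_\Delta(t)=\int_{-\infty}^{\infty}H(s)X_\Delta(t-s)\,ds,\qquad H_{T,\Delta}(\tau)=\frac1{cT}\int_0^T Y_\Delta(t+\tau)X_\Delta(t)\,dt,\qquad T,\Delta>0,\ \ t,\tau\in\mathbb R,$$ where the second integral is a mean-square Riemann integral and the first is the mean-square limit, as $a\to-\infty$ and $b\to\infty$, of mean-square Riemann integrals over $[a,b]$. Then these integrals exist for all $T,\Delta>0$ and $t,\tau\in\mathbb R$, and for every $\tau\in\mathbb R$ the estimator $H_{T,\Delta}(\tau)$ is mean-square consistent: $$\lim_{(T,\Delta)\to\infty}\mathsf E\,|H_{T,\Delta}(\tau)-H(\tau)|^2=0,$$ where $(T,\Delta)\to\infty$ means that $T\to\infty$ and $\Delta\to\infty$ simultaneously and otherwise arbitrarily. -/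

import Mathlib

open MeasureTheory ProbabilityTheory Filter Topology Set

namespace Correlogram

/-! ### Mean-square Riemann integrals of random processes -/

/-- A partition `a = node 0 ≤ … ≤ node n = b` of `[a, b]` with tags `tag i ∈ [node i, node (i+1)]`. -/
structure TaggedPartition (a b : ℝ) where
  n : ℕ
  node : ℕ → ℝ
  tag : ℕ → ℝ
  node_zero : node 0 = a
  node_last : node n = b
  tag_mem : ∀ i < n, tag i ∈ Icc (node i) (node (i + 1))

/-- All intervals of the partition are shorter than `δ`. -/
def TaggedPartition.FinerThan {a b : ℝ} (π : TaggedPartition a b) (δ : ℝ) : Prop :=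
  ∀ i < π.n, π.node (i + 1) - π.node i < δ

variable {Ω : Type*} [MeasurableSpace Ω]

/-- The Riemann sum of the random process `Z` along a tagged partition. -/
noncomputable def riemannSum {a b : ℝ} (Z : ℝ → Ω → ℝ) (π : TaggedPartition a b) (ω : Ω) : ℝ :=
  ∑ i ∈ Finset.range π.n, (π.node (i + 1) - π.node i) * Z (π.tag i) ω

/-- `I` is the mean-square Riemann integral `∫_a^b Z(t) dt` of the second-order process `Z`:
the limit in `L²(P)` of the Riemann sums as the mesh of the partition tends to zero. -/
structure HasMSIntegral (P : Measure Ω) (Z : ℝ → Ω → ℝ) (a b : ℝ) (I : Ω → ℝ) : Prop where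
  le : a ≤ b
  memLp_integrand : ∀ t ∈ Icc a b, MemLp (Z t) 2 P
  memLp : MemLp I 2 P
  limit : ∀ ε > (0 : ℝ), ∃ δ > (0 : ℝ), ∀ π : TaggedPartition a b, π.FinerThan δ →
    eLpNorm (fun ω => riemannSum Z π ω - I ω) 2 P ≤ ENNReal.ofReal ε

/-- `I` is the improper mean-square integral `∫_{-∞}^{∞} Z(t) dt`: the limit in `L²(P)` of the
mean-square Riemann integrals over `[a, b]` as `a → -∞` and `b → ∞` independently. -/
structure HasMSIntegralLine (P : Measure Ω) (Z : ℝ → Ω → ℝ) (I : Ω → ℝ) : Prop where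
  memLp : MemLp I 2 P
  limit : ∃ J : ℝ → ℝ → Ω → ℝ, (∀ a b, a ≤ b → HasMSIntegral P Z a b (J a b)) ∧
    Tendsto (fun p : ℝ × ℝ => eLpNorm (fun ω => J p.1 p.2 ω - I ω) 2 P) (atBot ×ˢ atTop) (𝓝 0)

open Classical in
/-- The mean-square Riemann integral over `[a, b]` (determined `P`-almost surely; the value is `0`
if the integral does not exist). -/
noncomputable def msIntegral (P : Measure Ω) (Z : ℝ → Ω → ℝ) (a b : ℝ) : Ω → ℝ :=
  if h : ∃ I, HasMSIntegral P Z a b I then h.choose else 0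

open Classical in
/-- The improper mean-square integral over the real line (determined `P`-almost surely; the value
is `0` if the integral does not exist). -/
noncomputable def msIntegralLine (P : Measure Ω) (Z : ℝ → Ω → ℝ) : Ω → ℝ :=
  if h : ∃ I, HasMSIntegralLine P Z I then h.choose else 0

/-! ### The input processes -/

/-- The correlation function `K(t) = E X(t) X(0)` of a centered stationary process `X`. -/
noncomputable def corr (P : Measure Ω) (X : ℝ → Ω → ℝ) (t : ℝ) : ℝ :=
  ∫ ω, X t ω * X 0 ω ∂P

/-- `f` is the spectral density of the centered process `X`:
`E X(s + t) X(s) = ∫ exp(i λ t) f(λ) dλ` for all `s` and `t`. In particular `X` is stationary in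
the wide sense, hence also in the strict sense if it is Gaussian. -/
def HasSpectralDensity (P : Measure Ω) (X : ℝ → Ω → ℝ) (f : ℝ → ℝ) : Prop :=
  ∀ s t : ℝ, ((∫ ω, X (s + t) ω * X s ω ∂P : ℝ) : ℂ) =
    ∫ l : ℝ, Complex.exp (Complex.I * l * t) * (f l : ℂ)

/-- `X Δ`, `Δ > 0`, are stationary centered real Gaussian processes with nonnegative continuous
spectral densities `f Δ`, approaching Gaussian white noise of intensity `c` as `Δ → ∞`. -/
structure IsInputFamily (P : Measure Ω) (X : ℝ → ℝ → Ω → ℝ) (f : ℝ → ℝ → ℝ) (c : ℝ) :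
    Prop where
  gaussian : ∀ Δ > 0, IsGaussianProcess (X Δ) P
  centered : ∀ Δ > 0, ∀ t, ∫ ω, X Δ t ω ∂P = 0
  spectral : ∀ Δ > 0, HasSpectralDensity P (X Δ) (f Δ)
  nonneg : ∀ Δ > 0, ∀ l, 0 ≤ f Δ l
  continuous : ∀ Δ > 0, Continuous (f Δ)
  even : ∀ Δ > 0, ∀ l, f Δ l = f Δ (-l)
  bounded : ∃ M : ℝ, ∀ Δ > 0, ∀ l, |f Δ l| ≤ M
  integrable : ∀ Δ > 0, Integrable (f Δ)
  c_pos : 0 < c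
  tendsto : ∀ a > 0, TendstoUniformlyOn f (fun _ => c / (2 * Real.pi)) atTop (Icc (-a) a)
  corr_integrable : ∀ Δ > 0, Integrable (corr P (X Δ))

/-- The conditions on the correlation functions `K Δ` with respect to the exponent `α`. -/
structure BalanceConditions (K : ℝ → ℝ → ℝ) (α : ℝ) : Prop where
  tail : ∀ δ > 0, Tendsto (fun Δ => ∫ t in Ioi δ, K Δ t) atTop (𝓝 0)
  tail_sq : ∀ δ > 0, Tendsto (fun Δ => ∫ t in Ioi δ, K Δ t ^ 2) atTop (𝓝 0)
  near_zero : ∃ δ > 0,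
    Tendsto (fun Δ => ∫ t in Icc (-δ) δ, |K Δ t| * |t| ^ α) atTop (𝓝 0)

/-! ### The transfer function, the response and the estimator -/

/-- `H ∈ Lip_α(ℝ)`: the Lipschitz condition with exponent `α` for nearby points, with constants
uniform on `ℝ`. -/
def IsLip (α : ℝ) (H : ℝ → ℝ) : Prop :=
  ∃ δ > 0, ∃ M > 0, ∀ t s : ℝ, |t - s| < δ → |H t - H s| ≤ M * |t - s| ^ α

/-- The response `Y(t) = ∫ H(s) X(t - s) ds` of the linear system with transfer function `H`. -/
noncomputable def response (P : Measure Ω) (H : ℝ → ℝ) (X : ℝ → Ω → ℝ) (t : ℝ) : Ω → ℝ :=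
  msIntegralLine P (fun s ω => H s * X (t - s) ω)

/-- The correlogram estimator `(1 / (c T)) ∫_0^T Y(t + τ) X(t) dt`. -/
noncomputable def estimator (P : Measure Ω) (c : ℝ) (H : ℝ → ℝ) (X : ℝ → Ω → ℝ) (T τ : ℝ)
    (ω : Ω) : ℝ :=
  1 / (c * T) * msIntegral P (fun t ω' => response P H X (t + τ) ω' * X t ω') 0 T ω

end Correlogram

namespace Correlogram

/-! ### Quadratic forms with a spectral density -/

section Kernel

variable {V : Type*} [NormedAddCommGroup V] [InnerProductSpace ℝ V]

/-! The argument takes place in the Hilbert space `L²(P)`. The input is a continuous curve `x`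
there, the response `y(t)` is an improper Bochner integral of `H s • x (t - s)`, and the estimator
is `1/(cT)` times the Bochner integral over `[0, T]` of `z(t) = y(t + τ) x(t)`. The squared error
therefore splits into squared bias plus variance.

The mean of `z(t)` is `∫ H(s) K(τ - s) ds`, whatever `t` is, so the bias depends on `Δ` only. By
Fourier inversion `∫ K = 2π f(0)`, which tends to `c`; the three balance conditions then make `K /
c` an approximate identity for `H` at `τ` (`tendsto_integral_mul_corr`).

For the variance, Wick's formula (`integral_mul_four`) writes the covariance of `z(t)` and `z(s)` as
`⟨y, y⟩ K(t - s)` plus a product of two mixed terms `⟨y, x⟩`. A kernel `K(t - s)` whose spectral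
density is at most `M` is bounded by `2πM` as a quadratic form (`integral_spectral_kernel_le`), and
duality gives a Bessel inequality for `x` (`setIntegral_inner_sq_le`). Each of the two parts then
integrates over `[0, T]²` to at most `2πM T sup ‖y‖²`, while `‖y‖² ≤ 2πM ∫ H²`. Since `M` is common
to all `Δ`, the variance is `O(1/T)` uniformly in `Δ`; hence `T` and `Δ` may grow independently.

Wick's formula applies to `y` because `y` lies in the closed span of the input, and centered
Gaussian laws survive `L²` limits. -/

theorem integrable_square_of_continuous {φ : ℝ × ℝ → ℝ} (hφ : Continuous φ) (a b : ℝ) :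
    Integrable φ ((volume.restrict (Icc a b)).prod (volume.restrict (Icc a b))) := by
  rw [Measure.prod_restrict]
  exact hφ.continuousOn.integrableOn_compact (isCompact_Icc.prod isCompact_Icc)

theorem integral_square_inner [CompleteSpace V] {u v : ℝ → V} (hu : Continuous u)
    (hv : Continuous v) (a b : ℝ) :
    ∫ q, inner ℝ (u q.1) (v q.2)
        ∂((volume.restrict (Icc a b)).prod (volume.restrict (Icc a b))) =
      inner ℝ (∫ t in Icc a b, u t) (∫ t in Icc a b, v t) := by
  have hui : Integrable u (volume.restrict (Icc a b)) :=
    hu.continuousOn.integrableOn_compact isCompact_Icc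
  have hvi : Integrable v (volume.restrict (Icc a b)) :=
    hv.continuousOn.integrableOn_compact isCompact_Icc
  rw [integral_prod _ (integrable_square_of_continuous (by fun_prop) a b)]
  have h1 : ∀ t, ∫ s in Icc a b, inner ℝ (u t) (v s) = inner ℝ (u t) (∫ s in Icc a b, v s) :=
    fun t => integral_inner hvi (u t)
  simp only [h1]
  simp only [real_inner_comm (∫ s in Icc a b, v s)]
  rw [integral_inner hui, real_inner_comm]

/-- The energy of the curve `y` over `[a, b]` at frequency `l`. -/
noncomputable def energy (y : ℝ → V) (a b l : ℝ) : ℝ :=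
  ∫ q, Real.cos (l * (q.1 - q.2)) * inner ℝ (y q.1) (y q.2)
    ∂((volume.restrict (Icc a b)).prod (volume.restrict (Icc a b)))

/-- By the addition formula for `cos (l t - l s)` the double integral is `‖∫ cos(l t) y‖² + ‖∫ sin(l
t) y‖²`. -/
theorem energy_nonneg [CompleteSpace V] {y : ℝ → V} (hy : Continuous y) (a b l : ℝ) :
    0 ≤ energy y a b l := by
  have h : ∀ q : ℝ × ℝ, Real.cos (l * (q.1 - q.2)) * inner ℝ (y q.1) (y q.2) =
      inner ℝ (Real.cos (l * q.1) • y q.1) (Real.cos (l * q.2) • y q.2) +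
      inner ℝ (Real.sin (l * q.1) • y q.1) (Real.sin (l * q.2) • y q.2) := by
    intro q
    rw [mul_sub, Real.cos_sub]
    simp only [inner_smul_left, inner_smul_right, conj_trivial]
    ring
  unfold energy
  simp only [h]
  rw [integral_add (integrable_square_of_continuous (by fun_prop) a b)
    (integrable_square_of_continuous (by fun_prop) a b),
    integral_square_inner (u := fun t => Real.cos (l * t) • y t)
      (v := fun t => Real.cos (l * t) • y t) (by fun_prop) (by fun_prop),
    integral_square_inner (u := fun t => Real.sin (l * t) • y t)
      (v := fun t => Real.sin (l * t) • y t) (by fun_prop) (by fun_prop)]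
  exact add_nonneg real_inner_self_nonneg real_inner_self_nonneg

theorem integrable_density_mul_kernel {p : ℝ → ℝ} (hp : Integrable p) {y : ℝ → V}
    (hy : Continuous y) (a b : ℝ) :
    Integrable (fun r : ℝ × (ℝ × ℝ) =>
      p r.1 * (Real.cos (r.1 * (r.2.1 - r.2.2)) * inner ℝ (y r.2.1) (y r.2.2)))
      (volume.prod ((volume.restrict (Icc a b)).prod (volume.restrict (Icc a b)))) := by
  have h1 := hp.mul_prod
    (integrable_square_of_continuous (φ := fun q => inner ℝ (y q.1) (y q.2)) (by fun_prop) a b)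
  have h2 := h1.bdd_mul (c := 1)
    (f := fun r : ℝ × (ℝ × ℝ) => Real.cos (r.1 * (r.2.1 - r.2.2)))
    (Continuous.aestronglyMeasurable (by fun_prop))
    (Eventually.of_forall fun r => by simpa using Real.abs_cos_le_one _)
  refine h2.congr (Eventually.of_forall fun r => ?_)
  simp only
  ring

theorem integral_density_mul_energy {p : ℝ → ℝ} (hp : Integrable p) {y : ℝ → V}
    (hy : Continuous y) (a b : ℝ) :
    ∫ l, p l * energy y a b l =
      ∫ q, (∫ l, Real.cos (l * (q.1 - q.2)) * p l) * inner ℝ (y q.1) (y q.2)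
        ∂((volume.restrict (Icc a b)).prod (volume.restrict (Icc a b))) := by
  unfold energy
  simp only [← integral_const_mul]
  rw [integral_integral_swap (integrable_density_mul_kernel hp hy a b)]
  congr 1 with q
  rw [← integral_mul_const]
  congr 1 with l
  ring

theorem integrable_density_mul_energy {p : ℝ → ℝ} (hp : Integrable p) {y : ℝ → V}
    (hy : Continuous y) (a b : ℝ) : Integrable (fun l => p l * energy y a b l) := by
  unfold energy
  simp only [← integral_const_mul]
  exact (integrable_density_mul_kernel hp hy a b).integral_prod_left

/-- The Gaussian serves as a cutoff in frequency: its transform is a positive even kernel, to which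
Schur's test applies. -/
theorem integral_cos_mul_gaussian {ε : ℝ} (hε : 0 < ε) (u : ℝ) :
    ∫ l : ℝ, Real.cos (l * u) * Real.exp (-ε * l ^ 2) =
      √(Real.pi / ε) * Real.exp (-(1 / (4 * ε)) * u ^ 2) := by
  have h := congrArg Complex.re
    (fourierIntegral_gaussian (b := (ε : ℂ)) (by simpa using hε) (u : ℂ))
  have hr : ((Real.pi / ε : ℂ) ^ (1 / 2 : ℂ) * Complex.exp (-(u : ℂ) ^ 2 / (4 * ε))).re =
      √(Real.pi / ε) * Real.exp (-(1 / (4 * ε)) * u ^ 2) := by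
    rw [Real.sqrt_eq_rpow]
    have : ((Real.pi / ε : ℂ) ^ (1 / 2 : ℂ) * Complex.exp (-(u : ℂ) ^ 2 / (4 * ε))) =
      (((Real.pi / ε) ^ (1 / 2 : ℝ) * Real.exp (-(1 / (4 * ε)) * u ^ 2) : ℝ) : ℂ) := by
      rw [Complex.ofReal_mul, Complex.ofReal_cpow (by positivity)]
      push_cast
      congr 2
      ring
    rw [this, Complex.ofReal_re]
  rw [hr] at h
  rw [← h, ← RCLike.re_eq_complex_re, ← integral_re]
  · congr 1 with l
    have : Complex.exp (Complex.I * u * l) * Complex.exp (-ε * (l : ℂ) ^ 2) =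
        Complex.exp ((l * u : ℝ) * Complex.I) * ((Real.exp (-ε * l ^ 2) : ℝ) : ℂ) := by
      push_cast
      congr 2
      ring
    rw [this, RCLike.re_eq_complex_re, Complex.re_mul_ofReal, Complex.exp_ofReal_mul_I_re]
  · have hi : Integrable (fun l : ℝ => Complex.exp (-ε * (l : ℂ) ^ 2)) :=
      integrable_cexp_neg_mul_sq (b := (ε : ℂ)) (by simpa using hε)
    refine hi.bdd_mul (c := 1) (Continuous.aestronglyMeasurable (by fun_prop))
      (Eventually.of_forall fun l => ?_)
    rw [show Complex.I * u * l = ((u * l : ℝ) : ℂ) * Complex.I by push_cast; ring,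
      Complex.norm_exp_ofReal_mul_I]

/-- The mass does not depend on `ε`, so removing the cutoff costs nothing; this is the source of the
factor `2π`. -/
theorem integral_scaled_gaussian {ε : ℝ} (hε : 0 < ε) :
    ∫ u : ℝ, √(Real.pi / ε) * Real.exp (-(1 / (4 * ε)) * u ^ 2) = 2 * Real.pi := by
  rw [integral_const_mul, integral_gaussian, ← Real.sqrt_mul (by positivity),
    show Real.pi / ε * (Real.pi / (1 / (4 * ε))) = (2 * Real.pi) ^ 2 by field_simp; ring,
    Real.sqrt_sq (by positivity)]

/-- Schur's test for a nonnegative even convolution kernel. -/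
theorem integral_convolution_kernel_le {g : ℝ → ℝ} (hg : Continuous g) (hgi : Integrable g)
    (hg0 : ∀ u, 0 ≤ g u) (hge : ∀ u, g (-u) = g u) {y : ℝ → V} (hy : Continuous y) (a b : ℝ) :
    ∫ q, g (q.1 - q.2) * inner ℝ (y q.1) (y q.2)
        ∂((volume.restrict (Icc a b)).prod (volume.restrict (Icc a b))) ≤
      (∫ u, g u) * ∫ t in Icc a b, ‖y t‖ ^ 2 := by
  set μ := (volume.restrict (Icc a b)).prod (volume.restrict (Icc a b)) with hμ
  have hi1 : Integrable (fun q : ℝ × ℝ => g (q.1 - q.2) * ‖y q.1‖ ^ 2) μ :=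
    integrable_square_of_continuous (by fun_prop) a b
  have hi2 : Integrable (fun q : ℝ × ℝ => g (q.1 - q.2) * ‖y q.2‖ ^ 2) μ :=
    integrable_square_of_continuous (by fun_prop) a b
  have hsymm : ∫ q, g (q.1 - q.2) * ‖y q.2‖ ^ 2 ∂μ = ∫ q, g (q.1 - q.2) * ‖y q.1‖ ^ 2 ∂μ := by
    rw [← integral_prod_swap]
    congr 1 with q
    simp only [Prod.fst_swap, Prod.snd_swap]
    rw [← hge, neg_sub]
  have hrow : ∫ q, g (q.1 - q.2) * ‖y q.1‖ ^ 2 ∂μ ≤ (∫ u, g u) * ∫ t in Icc a b, ‖y t‖ ^ 2 := by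
    rw [hμ, integral_prod _ hi1, ← integral_const_mul]
    refine integral_mono_of_nonneg (Eventually.of_forall fun t => integral_nonneg fun s =>
      mul_nonneg (hg0 _) (by positivity)) ?_ (Eventually.of_forall fun t => ?_)
    · exact Continuous.integrableOn_Icc (by fun_prop)
    · simp only
      rw [integral_mul_const]
      refine mul_le_mul_of_nonneg_right ?_ (by positivity)
      have := integral_sub_left_eq_self g volume t
      rw [← this]
      exact setIntegral_le_integral (hgi.comp_sub_left t) (Eventually.of_forall fun s => hg0 _)
  -- The inequality `2 ⟨u, v⟩ ≤ ‖u‖² + ‖v‖²` separates the variables; evenness of `g` makes the two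
  -- halves equal.
  calc _ ≤ ∫ q, (1 / 2) * (g (q.1 - q.2) * ‖y q.1‖ ^ 2) + (1 / 2) * (g (q.1 - q.2) * ‖y q.2‖ ^ 2)
          ∂μ := by
        refine integral_mono (integrable_square_of_continuous (by fun_prop) a b)
          ((hi1.const_mul _).add (hi2.const_mul _)) fun q => ?_
        have h1 := real_inner_le_norm (y q.1) (y q.2)
        have h2 := two_mul_le_add_sq ‖y q.1‖ ‖y q.2‖
        have h3 := mul_le_mul_of_nonneg_left
          (show inner ℝ (y q.1) (y q.2) ≤ (‖y q.1‖ ^ 2 + ‖y q.2‖ ^ 2) / 2 by linarith)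
          (hg0 (q.1 - q.2))
        simp only
        linarith
    _ = ∫ q, g (q.1 - q.2) * ‖y q.1‖ ^ 2 ∂μ := by
        rw [integral_add (hi1.const_mul _) (hi2.const_mul _), integral_const_mul,
          integral_const_mul, hsymm]
        ring
    _ ≤ _ := hrow

/-- A kernel with spectral density at most `M` is bounded by `2 π M` as a quadratic form. -/
theorem integral_spectral_kernel_le [CompleteSpace V] {f : ℝ → ℝ} (hf : Integrable f)
    {M : ℝ} (hM : 0 ≤ M) (hfM : ∀ l, f l ≤ M) {K : ℝ → ℝ}
    (hK : ∀ u, K u = ∫ l, Real.cos (l * u) * f l) {y : ℝ → V} (hy : Continuous y) (a b : ℝ) :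
    ∫ q, K (q.1 - q.2) * inner ℝ (y q.1) (y q.2)
        ∂((volume.restrict (Icc a b)).prod (volume.restrict (Icc a b))) ≤
      2 * Real.pi * M * ∫ t in Icc a b, ‖y t‖ ^ 2 := by
  simp only [hK]
  rw [← integral_density_mul_energy hf hy a b]
  have hfi := integrable_density_mul_energy hf hy a b
  -- With the cutoff in place `f` can be replaced by `M`, as the energy is nonnegative and the
  -- cutoff energy is integrable. Schur's test bounds the result uniformly in the cutoff, a
  -- substitute for Plancherel's identity.
  have hlim : Tendsto (fun n : ℕ => ∫ l, Real.exp (-(1 / ((n : ℝ) + 1)) * l ^ 2) *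
      (f l * energy y a b l)) atTop (𝓝 (∫ l, f l * energy y a b l)) := by
    refine tendsto_integral_of_dominated_convergence (fun l => ‖f l * energy y a b l‖)
      (fun n => ?_) hfi.norm (fun n => Eventually.of_forall fun l => ?_)
      (Eventually.of_forall fun l => ?_)
    · exact (Continuous.aestronglyMeasurable (by fun_prop)).mul hfi.aestronglyMeasurable
    · rw [norm_mul, Real.norm_eq_abs, abs_of_pos (Real.exp_pos _)]
      refine mul_le_of_le_one_left (norm_nonneg _) (Real.exp_le_one_iff.2 ?_)
      have : 0 ≤ 1 / ((n : ℝ) + 1) * l ^ 2 := by positivity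
      linarith
    · have h0 : Tendsto (fun n : ℕ => Real.exp (-(1 / ((n : ℝ) + 1)) * l ^ 2)) atTop
          (𝓝 (Real.exp (-0 * l ^ 2))) :=
        ((tendsto_one_div_add_atTop_nhds_zero_nat (𝕜 := ℝ)).neg.mul_const _).rexp
      simpa using h0.mul_const (f l * energy y a b l)
  refine le_of_tendsto' hlim fun n => ?_
  set ε : ℝ := 1 / ((n : ℝ) + 1) with hε
  have hεp : 0 < ε := by positivity
  have hgi : Integrable fun l : ℝ => Real.exp (-ε * l ^ 2) := integrable_exp_neg_mul_sq hεp
  have hge := integrable_density_mul_energy hgi hy a b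
  calc _ ≤ ∫ l, M * (Real.exp (-ε * l ^ 2) * energy y a b l) := by
        refine integral_mono (hfi.bdd_mul (c := 1) (Continuous.aestronglyMeasurable (by fun_prop))
          (Eventually.of_forall fun l => ?_)) (hge.const_mul M) fun l => ?_
        · rw [Real.norm_eq_abs, abs_of_pos (Real.exp_pos _)]
          refine Real.exp_le_one_iff.2 ?_
          have : 0 ≤ ε * l ^ 2 := by positivity
          linarith
        · have := mul_le_mul_of_nonneg_right (hfM l)
            (mul_nonneg (Real.exp_pos (-ε * l ^ 2)).le (energy_nonneg hy a b l))
          simp only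
          linarith
    _ = M * ∫ q, (√(Real.pi / ε) * Real.exp (-(1 / (4 * ε)) * (q.1 - q.2) ^ 2)) *
          inner ℝ (y q.1) (y q.2)
          ∂((volume.restrict (Icc a b)).prod (volume.restrict (Icc a b))) := by
        rw [integral_const_mul, integral_density_mul_energy hgi hy a b]
        simp only [integral_cos_mul_gaussian hεp]
    _ ≤ M * (2 * Real.pi * ∫ t in Icc a b, ‖y t‖ ^ 2) := by
        refine mul_le_mul_of_nonneg_left ?_ hM
        rw [← integral_scaled_gaussian hεp]
        refine integral_convolution_kernel_le
          (g := fun u => √(Real.pi / ε) * Real.exp (-(1 / (4 * ε)) * u ^ 2)) (by fun_prop)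
          ((integrable_exp_neg_mul_sq (by positivity)).const_mul _)
          (fun u => by positivity) (fun u => by simp) hy a b
    _ = _ := by ring

end Kernel

/-! ### Curves in a Hilbert space with a stationary correlation -/

section Curve

variable {V : Type*} [NormedAddCommGroup V] [InnerProductSpace ℝ V]

/-- The curve `x` is continuous and has a stationary correlation function `K` whose spectral
density is at most `M`. -/
structure IsSpectralCurve (x : ℝ → V) (K f : ℝ → ℝ) (M : ℝ) : Prop where
  continuous : Continuous x
  inner_eq : ∀ s t, inner ℝ (x s) (x t) = K (s - t)
  integrable : Integrable f
  le : ∀ l, f l ≤ M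
  nonneg : 0 ≤ M
  spectral : ∀ u, K u = ∫ l, Real.cos (l * u) * f l

namespace IsSpectralCurve

variable {x : ℝ → V} {K f : ℝ → ℝ} {M : ℝ}

theorem corr_neg (hx : IsSpectralCurve x K f M) (u : ℝ) : K (-u) = K u := by
  simp only [hx.spectral, mul_neg, Real.cos_neg]

theorem continuous_corr (hx : IsSpectralCurve x K f M) : Continuous K := by
  have hc := hx.continuous
  have h : K = fun u => inner ℝ (x u) (x 0) := funext fun u => by rw [hx.inner_eq, sub_zero]
  rw [h]
  fun_prop

theorem comp_sub_left (hx : IsSpectralCurve x K f M) (t : ℝ) :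
    IsSpectralCurve (fun s => x (t - s)) K f M where
  continuous := hx.continuous.comp (by fun_prop)
  inner_eq s s' := by rw [hx.inner_eq, ← hx.corr_neg]; congr 1; ring
  integrable := hx.integrable
  le := hx.le
  nonneg := hx.nonneg
  spectral := hx.spectral

variable [CompleteSpace V]

/-- The square expands into the quadratic form of `K(s - t)` at the scalar curve `g`, so the kernel
bound is used with `V = ℝ`. -/
theorem norm_setIntegral_smul_sq_le (hx : IsSpectralCurve x K f M) {g : ℝ → ℝ}
    (hg : Continuous g) (a b : ℝ) :
    ‖∫ s in Icc a b, g s • x s‖ ^ 2 ≤ 2 * Real.pi * M * ∫ s in Icc a b, g s ^ 2 := by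
  have hc := hx.continuous
  rw [← real_inner_self_eq_norm_sq, ← integral_square_inner (u := fun s => g s • x s)
    (v := fun s => g s • x s) (by fun_prop) (by fun_prop)]
  have h := integral_spectral_kernel_le hx.integrable hx.nonneg hx.le hx.spectral hg a b
  simp only [Real.norm_eq_abs, sq_abs] at h
  refine le_of_eq_of_le ?_ h
  congr 1 with q
  rw [inner_smul_left, inner_smul_right, hx.inner_eq, real_inner_eq_re_inner]
  simp
  ring

theorem norm_intervalIntegral_smul_sq_le (hx : IsSpectralCurve x K f M) {g : ℝ → ℝ}
    (hg : Continuous g) {a b : ℝ} (hab : a ≤ b) :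
    ‖∫ s in a..b, g s • x s‖ ^ 2 ≤ 2 * Real.pi * M * ∫ s in a..b, g s ^ 2 := by
  rw [intervalIntegral.integral_of_le hab, intervalIntegral.integral_of_le hab,
    ← integral_Icc_eq_integral_Ioc, ← integral_Icc_eq_integral_Ioc]
  exact hx.norm_setIntegral_smul_sq_le hg a b

/-- Bessel's inequality for a curve with a bounded spectral density. -/
theorem setIntegral_inner_sq_le (hx : IsSpectralCurve x K f M) (v : V) (a b : ℝ) :
    ∫ s in Icc a b, (inner ℝ v (x s)) ^ 2 ≤ 2 * Real.pi * M * ‖v‖ ^ 2 := by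
  have hc := hx.continuous
  have hg : Continuous fun s => inner ℝ v (x s) := by fun_prop
  have h := hx.norm_setIntegral_smul_sq_le hg a b
  have hi : ∫ s in Icc a b, (inner ℝ v (x s)) ^ 2 =
      inner ℝ v (∫ s in Icc a b, (inner ℝ v (x s)) • x s) := by
    rw [← integral_inner (Continuous.integrableOn_Icc (by fun_prop))]
    congr 1 with s
    rw [inner_smul_right, sq]
  -- Duality: with `A` the integral to be bounded, `A = ⟨v, ∫ ⟨v, x⟩ x⟩ ≤ ‖v‖ √(2πM A)`. Division by
  -- `A` needs the case `A = 0` set apart.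
  have hcs := real_inner_le_norm v (∫ s in Icc a b, (inner ℝ v (x s)) • x s)
  rw [← hi] at hcs
  have hA : 0 ≤ ∫ s in Icc a b, (inner ℝ v (x s)) ^ 2 := integral_nonneg fun s => sq_nonneg _
  have hM : 0 ≤ 2 * Real.pi * M * ‖v‖ ^ 2 :=
    mul_nonneg (mul_nonneg (by positivity) hx.nonneg) (by positivity)
  set A := ∫ s in Icc a b, (inner ℝ v (x s)) ^ 2
  rcases hA.eq_or_lt with h0 | h0
  · rw [← h0]; exact hM
  · have h1 : A ^ 2 ≤ ‖v‖ ^ 2 * (2 * Real.pi * M * A) := by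
      calc A ^ 2 ≤ (‖v‖ * ‖∫ s in Icc a b, (inner ℝ v (x s)) • x s‖) ^ 2 := by gcongr
        _ = ‖v‖ ^ 2 * ‖∫ s in Icc a b, (inner ℝ v (x s)) • x s‖ ^ 2 := by ring
        _ ≤ _ := by gcongr
    refine le_of_mul_le_mul_right ?_ h0
    linarith

end IsSpectralCurve

variable [CompleteSpace V]

/-- In the application `F` is a primitive of `H²`. As the increment bound does not involve `t`, the
Cauchy property passes from `F` to `g t` and convergence is uniform in `t`, which preserves
continuity. -/
theorem exists_continuous_tendsto {V : Type*} [NormedAddCommGroup V] [CompleteSpace V]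
    {l : Filter ℝ} [l.NeBot] {F : ℝ → ℝ} {L : ℝ}
    (hF : Tendsto F l (𝓝 L)) {g : ℝ → ℝ → V} (hg : ∀ b, Continuous fun t => g t b) {C : ℝ}
    (hC : 0 ≤ C) (hgF : ∀ t b b', ‖g t b - g t b'‖ ^ 2 ≤ C * |F b - F b'|) :
    ∃ y : ℝ → V, Continuous y ∧ ∀ t, Tendsto (g t) l (𝓝 (y t)) := by
  have hex : ∀ t, ∃ y, Tendsto (g t) l (𝓝 y) := by
    intro t
    refine cauchy_map_iff_exists_tendsto.1 ?_
    refine Metric.cauchy_iff.2 ⟨inferInstance, fun ε hε => ?_⟩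
    have hd : 0 < ε ^ 2 / (C + 1) := by positivity
    obtain ⟨s, hs, hsF⟩ := (Metric.cauchy_iff.1 hF.cauchy_map).2 _ hd
    refine ⟨g t '' (F ⁻¹' s), image_mem_map hs, ?_⟩
    rintro _ ⟨b, hb, rfl⟩ _ ⟨b', hb', rfl⟩
    have h1 := hsF _ hb _ hb'
    rw [Real.dist_eq, lt_div_iff₀ (by positivity)] at h1
    rw [dist_eq_norm]
    refine lt_of_pow_lt_pow_left₀ 2 hε.le ((hgF t b b').trans_lt ?_)
    nlinarith [abs_nonneg (F b - F b')]
  choose y hy using hex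
  refine ⟨y, ?_, hy⟩
  have hle : ∀ t b, ‖g t b - y t‖ ^ 2 ≤ C * |F b - L| := fun t b =>
    le_of_tendsto_of_tendsto' ((tendsto_const_nhds.sub (hy t)).norm.pow 2)
      ((tendsto_const_nhds.sub hF).abs.const_mul C) (hgF t b)
  have hu : TendstoUniformly (fun b t => g t b) y l := by
    refine Metric.tendstoUniformly_iff.2 fun ε hε => ?_
    have hd : 0 < ε ^ 2 / (C + 1) := by positivity
    filter_upwards [Metric.tendsto_nhds.1 hF _ hd] with b hb t
    rw [Real.dist_eq, lt_div_iff₀ (by positivity)] at hb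
    rw [dist_comm, dist_eq_norm]
    refine lt_of_pow_lt_pow_left₀ 2 hε.le ((hle t b).trans_lt ?_)
    nlinarith [abs_nonneg (F b - L)]
  exact hu.continuous (Frequently.of_forall hg)

/-- The curve `y(t) = ∫ H(s) x(t - s) ds`, an improper integral, and its continuity. -/
theorem IsSpectralCurve.exists_response {x : ℝ → V} {K f : ℝ → ℝ} {M : ℝ}
    (hx : IsSpectralCurve x K f M) {H : ℝ → ℝ} (hH : Continuous H)
    (hH2 : Integrable fun s => H s ^ 2) :
    ∃ y : ℝ → V, Continuous y ∧ ∀ t, Tendsto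
      (fun p : ℝ × ℝ => ∫ s in p.1..p.2, H s • x (t - s)) (atBot ×ˢ atTop) (𝓝 (y t)) := by
  have hxc := hx.continuous
  have hint : ∀ t a b, IntervalIntegrable (fun s => H s • x (t - s)) volume a b :=
    fun t a b => Continuous.intervalIntegrable (by fun_prop) a b
  have hint2 : ∀ a b, IntervalIntegrable (fun s => H s ^ 2) volume a b :=
    fun a b => hH2.intervalIntegrable
  have hM := hx.nonneg
  have hle : ∀ t b b', ‖(∫ s in (0 : ℝ)..b, H s • x (t - s)) - ∫ s in (0 : ℝ)..b', H s • x (t - s)‖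
      ^ 2 ≤ 2 * Real.pi * M * |(∫ s in (0 : ℝ)..b, H s ^ 2) - ∫ s in (0 : ℝ)..b', H s ^ 2| := by
    intro t b b'
    wlog h : b' ≤ b generalizing b b'
    · rw [norm_sub_rev, abs_sub_comm]
      exact this b' b (le_of_not_ge h)
    rw [intervalIntegral.integral_interval_sub_left (hint t _ _) (hint t _ _),
      intervalIntegral.integral_interval_sub_left (hint2 _ _) (hint2 _ _)]
    refine ((hx.comp_sub_left t).norm_intervalIntegral_smul_sq_le hH h).trans ?_
    exact mul_le_mul_of_nonneg_left (le_abs_self _) (by positivity)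
  have hcont : ∀ b, Continuous fun t => ∫ s in (0 : ℝ)..b, H s • x (t - s) := fun b =>
    intervalIntegral.continuous_parametric_intervalIntegral_of_continuous' (by fun_prop) _ _
  obtain ⟨yp, hypc, hyp⟩ := exists_continuous_tendsto
    (intervalIntegral_tendsto_integral_Ioi 0 hH2.integrableOn tendsto_id) hcont
    (by positivity) hle
  -- The two ends are treated separately, through the same integrals from `0`; the limits are then
  -- independent, as the product filter requires.
  have hbot : Tendsto (fun b => ∫ s in (0 : ℝ)..b, H s ^ 2) atBot
      (𝓝 (-∫ s in Iic (0 : ℝ), H s ^ 2)) := by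
    have := (intervalIntegral_tendsto_integral_Iic 0 hH2.integrableOn tendsto_id).neg
    refine this.congr fun b => ?_
    rw [intervalIntegral.integral_symm, neg_neg, id]
  obtain ⟨ym, hymc, hym⟩ := exists_continuous_tendsto hbot hcont (by positivity) hle
  refine ⟨fun t => yp t - ym t, hypc.sub hymc, fun t => ?_⟩
  refine (((hyp t).comp tendsto_snd).sub ((hym t).comp tendsto_fst)).congr fun p => ?_
  exact intervalIntegral.integral_interval_sub_left (hint t _ _) (hint t _ _)

theorem eventually_fst_le_snd : ∀ᶠ p : ℝ × ℝ in atBot ×ˢ atTop, p.1 ≤ p.2 := by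
  filter_upwards [tendsto_fst.eventually (eventually_le_atBot (0 : ℝ)),
    tendsto_snd.eventually (eventually_ge_atTop (0 : ℝ))] with p h1 h2 using h1.trans h2

/-! ### Size, correlation with the input, and location of the response. -/

section Response

variable {x y : ℝ → V} {K f : ℝ → ℝ} {M : ℝ} {H : ℝ → ℝ}

theorem IsSpectralCurve.norm_response_sq_le (hx : IsSpectralCurve x K f M) (hH : Continuous H)
    (hH2 : Integrable fun s => H s ^ 2) {t : ℝ}
    (hy : Tendsto (fun p : ℝ × ℝ => ∫ s in p.1..p.2, H s • x (t - s)) (atBot ×ˢ atTop)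
      (𝓝 (y t))) :
    ‖y t‖ ^ 2 ≤ 2 * Real.pi * M * ∫ s, H s ^ 2 := by
  have hM := hx.nonneg
  refine le_of_tendsto (hy.norm.pow 2) ?_
  filter_upwards [eventually_fst_le_snd] with p hp
  refine ((hx.comp_sub_left t).norm_intervalIntegral_smul_sq_le hH hp).trans ?_
  refine mul_le_mul_of_nonneg_left ?_ (by positivity)
  rw [intervalIntegral.integral_of_le hp]
  exact setIntegral_le_integral hH2 (Eventually.of_forall fun s => sq_nonneg _)

/-- This is the mean of the estimator up to the factor `1/c`. Continuity of the inner product moves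
the improper limit outside, and integrability of `H K(τ - ·)` identifies it with a Lebesgue
integral. -/
theorem IsSpectralCurve.inner_response_eq (hx : IsSpectralCurve x K f M) (hH : Continuous H)
    {t τ : ℝ} (hHK : Integrable fun s => H s * K (τ - s))
    (hy : Tendsto (fun p : ℝ × ℝ => ∫ s in p.1..p.2, H s • x (t + τ - s)) (atBot ×ˢ atTop)
      (𝓝 (y (t + τ)))) :
    inner ℝ (y (t + τ)) (x t) = ∫ s, H s * K (τ - s) := by
  have hxc := hx.continuous
  have h1 := hy.inner (𝕜 := ℝ) (tendsto_const_nhds (x := x t))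
  have h2 := intervalIntegral_tendsto_integral hHK (tendsto_fst (f := atBot) (g := atTop))
    (tendsto_snd (f := atBot) (g := atTop))
  refine tendsto_nhds_unique h1 (h2.congr fun p => ?_)
  have h3 := ContinuousLinearMap.intervalIntegral_comp_comm (innerSL ℝ (x t))
    (μ := volume) (a := p.1) (b := p.2) (f := fun s => H s • x (t + τ - s))
    (Continuous.intervalIntegrable (by fun_prop) _ _)
  rw [real_inner_comm, ← innerSL_apply_apply ℝ, ← h3]
  congr 1 with s
  rw [innerSL_apply_apply, inner_smul_right, hx.inner_eq, ← hx.corr_neg]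
  congr 2
  ring

/-- The closure is the double orthogonal complement: a vector orthogonal to every `x s` is
orthogonal to each truncated integral and so to the limit. This places the response in the Gaussian
Hilbert space of the input. -/
theorem response_mem_closure_span (hxc : Continuous x) (hH : Continuous H) {t : ℝ}
    (hy : Tendsto (fun p : ℝ × ℝ => ∫ s in p.1..p.2, H s • x (t - s)) (atBot ×ˢ atTop)
      (𝓝 (y t))) :
    y t ∈ (Submodule.span ℝ (range x)).topologicalClosure := by
  rw [← Submodule.orthogonal_orthogonal_eq_closure, Submodule.mem_orthogonal]
  intro w hw
  have h1 := (tendsto_const_nhds (x := w)).inner (𝕜 := ℝ) hy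
  refine tendsto_nhds_unique h1 (tendsto_const_nhds.congr fun p => ?_)
  have h3 := ContinuousLinearMap.intervalIntegral_comp_comm (innerSL ℝ w)
    (μ := volume) (a := p.1) (b := p.2) (f := fun s => H s • x (t - s))
    (Continuous.intervalIntegrable (by fun_prop) _ _)
  rw [← innerSL_apply_apply ℝ, ← h3]
  have h4 : ∀ s, inner ℝ w (x s) = 0 := fun s => by
    rw [real_inner_comm]
    exact (Submodule.mem_orthogonal _ _).1 hw _ (Submodule.subset_span (mem_range_self s))
  simp [innerSL_apply_apply, h4]

end Response

/-- The quadratic error of a time average of a process whose covariance is given by Wick's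
formula for `y(t + τ) x(t)`. -/
theorem IsSpectralCurve.norm_average_sub_sq_le {W : Type*} [NormedAddCommGroup W]
    [InnerProductSpace ℝ W] [CompleteSpace W] {x y : ℝ → V} {K f : ℝ → ℝ} {M : ℝ}
    (hx : IsSpectralCurve x K f M) (hy : Continuous y) {B : ℝ} (hB : ∀ t, ‖y t‖ ^ 2 ≤ B)
    {z : ℝ → W} (hz : Continuous z) {e : W} (he : ‖e‖ = 1) {m τ : ℝ}
    (hze : ∀ t, inner ℝ (z t) e = m)
    (hzz : ∀ t s, inner ℝ (z t) (z s) = m ^ 2 + inner ℝ (y (t + τ)) (y (s + τ)) * K (t - s) +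
      inner ℝ (y (t + τ)) (x s) * inner ℝ (y (s + τ)) (x t))
    {c T : ℝ} (hc : 0 < c) (hT : 0 < T) (h : ℝ) :
    ‖(1 / (c * T)) • (∫ t in (0 : ℝ)..T, z t) - h • e‖ ^ 2 ≤
      (1 / c * m - h) ^ 2 + 4 * Real.pi * M * B / c ^ 2 * (1 / T) := by
  have hxc := hx.continuous
  have hM := hx.nonneg
  have hKc := hx.continuous_corr
  have hvol : volume.real (Icc 0 T) = T := by simp [hT.le]
  rw [intervalIntegral.integral_of_le hT.le, ← integral_Icc_eq_integral_Ioc]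
  set μ := (volume.restrict (Icc 0 T)).prod (volume.restrict (Icc 0 T)) with hμ
  set Z := ∫ t in Icc 0 T, z t with hZ
  have hZe : inner ℝ Z e = T * m := by
    rw [real_inner_comm, hZ, ← integral_inner hz.integrableOn_Icc]
    simp only [fun t => (real_inner_comm (z t) e).trans (hze t)]
    rw [setIntegral_const, hvol, smul_eq_mul]
  -- First Wick term: the spectral kernel bound for the shifted curve `y(· + τ)`.
  have hI1 : ∫ q, K (q.1 - q.2) * inner ℝ (y (q.1 + τ)) (y (q.2 + τ)) ∂μ ≤
      2 * Real.pi * M * (T * B) := by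
    refine (integral_spectral_kernel_le hx.integrable hx.nonneg hx.le hx.spectral
      (y := fun t => y (t + τ)) (by fun_prop) 0 T).trans ?_
    refine mul_le_mul_of_nonneg_left ?_ (by positivity)
    calc _ ≤ ∫ t in Icc 0 T, B := integral_mono (Continuous.integrableOn_Icc (by fun_prop))
          (Continuous.integrableOn_Icc (by fun_prop)) fun t => hB _
      _ = T * B := by rw [setIntegral_const, hvol, smul_eq_mul]
  have hc1 : Integrable (fun q : ℝ × ℝ => inner ℝ (y (q.1 + τ)) (x q.2) ^ 2) μ :=
    integrable_square_of_continuous (by fun_prop) 0 T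
  have hc2 : Integrable (fun q : ℝ × ℝ => inner ℝ (y (q.2 + τ)) (x q.1) ^ 2) μ :=
    integrable_square_of_continuous (by fun_prop) 0 T
  have hsw : ∫ q, inner ℝ (y (q.2 + τ)) (x q.1) ^ 2 ∂μ =
      ∫ q, inner ℝ (y (q.1 + τ)) (x q.2) ^ 2 ∂μ := by
    rw [← integral_prod_swap]
    rfl
  -- Second Wick term: the product is dominated by squares, and Bessel's inequality in `s` is
  -- applied for each fixed `t`.
  have hI2 : ∫ q, inner ℝ (y (q.1 + τ)) (x q.2) * inner ℝ (y (q.2 + τ)) (x q.1) ∂μ ≤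
      2 * Real.pi * M * (T * B) := by
    calc _ ≤ ∫ q, (1 / 2) * inner ℝ (y (q.1 + τ)) (x q.2) ^ 2 +
          (1 / 2) * inner ℝ (y (q.2 + τ)) (x q.1) ^ 2 ∂μ := by
          refine integral_mono (integrable_square_of_continuous (by fun_prop) 0 T)
            ((hc1.const_mul _).add (hc2.const_mul _)) fun q => ?_
          have := two_mul_le_add_sq (inner ℝ (y (q.1 + τ)) (x q.2)) (inner ℝ (y (q.2 + τ)) (x q.1))
          simp only
          linarith
      _ = ∫ q, inner ℝ (y (q.1 + τ)) (x q.2) ^ 2 ∂μ := by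
          rw [integral_add (hc1.const_mul _) (hc2.const_mul _), integral_const_mul,
            integral_const_mul, hsw]
          ring
      _ = ∫ t in Icc 0 T, ∫ s in Icc 0 T, inner ℝ (y (t + τ)) (x s) ^ 2 :=
          integral_prod _ hc1
      _ ≤ ∫ t in Icc 0 T, 2 * Real.pi * M * B := by
          refine integral_mono_of_nonneg (Eventually.of_forall fun t => integral_nonneg fun s =>
            sq_nonneg _) (Continuous.integrableOn_Icc (by fun_prop))
            (Eventually.of_forall fun t => ?_)
          exact (hx.setIntegral_inner_sq_le _ 0 T).trans
            (mul_le_mul_of_nonneg_left (hB _) (by positivity))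
      _ = _ := by rw [setIntegral_const, hvol, smul_eq_mul]; ring
  have hZZ : ‖Z‖ ^ 2 = (T * m) ^ 2 +
      ∫ q, K (q.1 - q.2) * inner ℝ (y (q.1 + τ)) (y (q.2 + τ)) ∂μ +
      ∫ q, inner ℝ (y (q.1 + τ)) (x q.2) * inner ℝ (y (q.2 + τ)) (x q.1) ∂μ := by
    rw [← real_inner_self_eq_norm_sq, hZ, ← integral_square_inner hz hz]
    simp only [hzz]
    rw [integral_add, integral_add]
    · congr 1
      · congr 1
        · rw [integral_prod _ (integrable_square_of_continuous (by fun_prop) 0 T)]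
          simp only [setIntegral_const, hvol, smul_eq_mul]
          ring
        · simp only [mul_comm, hμ]
    all_goals exact integrable_square_of_continuous (by fun_prop) 0 T
  rw [norm_sub_sq_real, norm_smul, norm_smul, he, mul_pow, inner_smul_left, inner_smul_right, hZe,
    hZZ, mul_one, Real.norm_eq_abs, Real.norm_eq_abs, sq_abs, sq_abs, conj_trivial]
  set I1 := ∫ q, K (q.1 - q.2) * inner ℝ (y (q.1 + τ)) (y (q.2 + τ)) ∂μ
  set I2 := ∫ q, inner ℝ (y (q.1 + τ)) (x q.2) * inner ℝ (y (q.2 + τ)) (x q.1) ∂μ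
  -- The part `(T m)²` and the inner product with `h • e` complete the squared bias; `I1 + I2` is
  -- the unnormalized variance.
  calc _ = (1 / c * m - h) ^ 2 + (1 / (c * T)) ^ 2 * (I1 + I2) := by field_simp; ring
    _ ≤ (1 / c * m - h) ^ 2 + (1 / (c * T)) ^ 2 *
          (2 * Real.pi * M * (T * B) + 2 * Real.pi * M * (T * B)) := by gcongr
    _ = _ := by field_simp; ring

end Curve

/-! ### Convergence of the mean of the estimator -/

/-- The integral of a correlation function is `2 π` times the value at `0` of its spectral
density. -/
theorem integral_eq_two_pi_mul_spectral_density {f K : ℝ → ℝ} (hf : Continuous f)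
    (hfi : Integrable f) (hKi : Integrable K)
    (hK : ∀ t : ℝ, (K t : ℂ) = ∫ l : ℝ, Complex.exp (Complex.I * l * t) * (f l : ℂ)) :
    ∫ t, K t = 2 * Real.pi * f 0 := by
  -- The Fourier transform here uses the phase `-2π l w`, hence the rescaled argument; integrability
  -- of `K` is what permits inversion at `0`.
  have hF : FourierTransform.fourier (fun l => (f l : ℂ)) =
      fun w : ℝ => ((K (-2 * Real.pi * w) : ℝ) : ℂ) := by
    ext w
    rw [Real.fourier_real_eq_integral_exp_smul, hK]
    congr 1 with l
    rw [smul_eq_mul]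
    congr 2
    push_cast
    ring
  have hc : (-2 * Real.pi : ℝ) ≠ 0 := by simp [Real.pi_ne_zero]
  have hinv := congrFun (Continuous.fourierInv_fourier_eq (f := fun l => (f l : ℂ))
    (by fun_prop) hfi.ofReal (by rw [hF]; exact (hKi.comp_mul_left' hc).ofReal)) 0
  rw [hF, Real.fourierInv_eq'] at hinv
  simp only [inner_zero_right, mul_zero, Complex.ofReal_zero, zero_mul, Complex.exp_zero,
    one_smul] at hinv
  rw [integral_complex_ofReal, Complex.ofReal_inj, Measure.integral_comp_mul_left, smul_eq_mul,
    abs_inv, show |-2 * Real.pi| = 2 * Real.pi by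
      rw [neg_mul, abs_neg, abs_of_pos Real.two_pi_pos]] at hinv
  rw [← hinv]
  field_simp

theorem setIntegral_compl_Icc_of_even {g : ℝ → ℝ} (hg : Integrable g) (he : ∀ u, g (-u) = g u)
    {δ : ℝ} (hδ : 0 < δ) : ∫ u in (Icc (-δ) δ)ᶜ, g u = 2 * ∫ u in Ioi δ, g u := by
  have hset : (Icc (-δ) δ)ᶜ = Iio (-δ) ∪ Ioi δ := by
    ext u
    simp only [mem_compl_iff, mem_Icc, not_and_or, not_le, mem_union, mem_Iio, mem_Ioi]
  rw [hset, setIntegral_union _ measurableSet_Ioi hg.integrableOn hg.integrableOn,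
    ← integral_Iic_eq_integral_Iio, ← integral_comp_neg_Ioi]
  · simp only [he]
    ring
  · rw [Set.disjoint_left]
    intro u h1 h2
    simp only [mem_Iio, mem_Ioi] at h1 h2
    linarith

theorem abs_setIntegral_mul_le {g k : ℝ → ℝ} (hg : MemLp g 2) (hk : MemLp k 2) (s : Set ℝ) :
    |∫ u in s, g u * k u| ≤
      (∫ u, g u ^ 2) ^ (1 / 2 : ℝ) * (∫ u in s, k u ^ 2) ^ (1 / 2 : ℝ) := by
  have h := integral_mul_norm_le_Lp_mul_Lq (μ := volume.restrict s) (f := g) (g := k)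
    Real.HolderConjugate.two_two (by simpa using hg.restrict s) (by simpa using hk.restrict s)
  simp only [Real.rpow_ofNat, Real.norm_eq_abs, sq_abs] at h
  calc _ ≤ ∫ u in s, |g u| * |k u| := by
        simpa only [abs_mul] using abs_integral_le_integral_abs (f := fun u => g u * k u)
          (μ := volume.restrict s)
    _ ≤ _ := h
    _ ≤ _ := by
        gcongr
        · exact Eventually.of_forall fun u => sq_nonneg _
        · exact hg.integrable_sq
        · exact Measure.restrict_le_self

theorem abs_setIntegral_Icc_sub_mul_le {g k : ℝ → ℝ} {α δ L h : ℝ} (hg : Continuous g)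
    (hk : Continuous k) (hα : 0 ≤ α) (hlip : ∀ u ∈ Icc (-δ) δ, |g u - h| ≤ L * |u| ^ α) :
    |∫ u in Icc (-δ) δ, (g u - h) * k u| ≤ L * ∫ u in Icc (-δ) δ, |k u| * |u| ^ α := by
  have hc : Continuous fun u : ℝ => |u| ^ α := continuous_abs.rpow_const fun _ => Or.inr hα
  rw [← integral_const_mul]
  refine abs_integral_le_integral_abs.trans (setIntegral_mono_on
    (Continuous.integrableOn_Icc (by fun_prop)) (Continuous.integrableOn_Icc (by fun_prop))
    measurableSet_Icc fun u hu => ?_)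
  rw [abs_mul]
  have := mul_le_mul_of_nonneg_right (hlip u hu) (abs_nonneg (k u))
  linarith

/-- `K` may change sign, so mass concentration alone does not suffice. On `[-δ, δ]` the oscillation
of `H` is paid for by `near_zero`, and the mass there tends to `c` by `tail`. Outside,
Cauchy–Schwarz with `H ∈ L²` leaves `tail_sq`. -/
theorem tendsto_integral_mul_corr {K : ℝ → ℝ → ℝ} {α c : ℝ} (hα : 0 < α)
    (hK : BalanceConditions K α) (hKi : ∀ Δ > 0, Integrable (K Δ))
    (hKc : ∀ Δ > 0, Continuous (K Δ)) (hK2 : ∀ Δ > 0, MemLp (K Δ) 2)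
    (hKe : ∀ Δ > 0, ∀ u, K Δ (-u) = K Δ u)
    (hKt : Tendsto (fun Δ => ∫ u, K Δ u) atTop (𝓝 c))
    {H : ℝ → ℝ} (hHc : Continuous H) (hH : IsLip α H) (hH2 : MemLp H 2) (τ : ℝ) :
    Tendsto (fun Δ => ∫ s, H s * K Δ (τ - s)) atTop (𝓝 (c * H τ)) := by
  obtain ⟨δ₁, hδ₁, hnear⟩ := hK.near_zero
  obtain ⟨δ₂, hδ₂, L, hL, hlip⟩ := hH
  -- Halving `δ₂` makes the closed condition `|u| ≤ δ` imply the strict one in `IsLip`.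
  set δ := min δ₁ (δ₂ / 2) with hδdef
  have hδ : 0 < δ := lt_min hδ₁ (half_pos hδ₂)
  have hpow : Continuous fun u : ℝ => |u| ^ α := continuous_abs.rpow_const fun _ => Or.inr hα.le
  have hpos : ∀ᶠ Δ : ℝ in atTop, 0 < Δ := eventually_gt_atTop 0
  have hnear' : Tendsto (fun Δ => ∫ t in Icc (-δ) δ, |K Δ t| * |t| ^ α) atTop (𝓝 0) := by
    refine squeeze_zero' (Eventually.of_forall fun Δ => integral_nonneg fun t => by positivity)
      ?_ hnear
    filter_upwards [hpos] with Δ hΔ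
    have := hKc Δ hΔ
    exact setIntegral_mono_set (Continuous.integrableOn_Icc (by fun_prop))
      (Eventually.of_forall fun t => by positivity)
      (LE.le.eventuallyLE
        (Icc_subset_Icc (neg_le_neg (min_le_left _ _)) (min_le_left _ _)))
  have hcen : Tendsto (fun Δ => |(∫ u, K Δ u) - 2 * (∫ u in Ioi δ, K Δ u) - c|) atTop (𝓝 0) := by
    simpa using ((hKt.sub ((hK.tail δ hδ).const_mul 2)).sub_const c).abs
  have htail : Tendsto (fun Δ => (2 * ∫ u in Ioi δ, K Δ u ^ 2) ^ (1 / 2 : ℝ)) atTop (𝓝 0) := by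
    have h := ((hK.tail_sq δ hδ).const_mul 2).rpow_const (p := (1 / 2 : ℝ)) (Or.inr (by norm_num))
    simpa using h
  set g : ℝ → ℝ := fun u => H (τ - u) with hg
  have hgc : Continuous g := by fun_prop
  have hg2 : MemLp g 2 := hH2.comp_measurePreserving (Measure.measurePreserving_sub_left volume τ)
  have hbound : Tendsto (fun Δ => L * (∫ t in Icc (-δ) δ, |K Δ t| * |t| ^ α) +
      |H τ| * |(∫ u, K Δ u) - 2 * (∫ u in Ioi δ, K Δ u) - c| +
      (∫ u, g u ^ 2) ^ (1 / 2 : ℝ) * (2 * ∫ u in Ioi δ, K Δ u ^ 2) ^ (1 / 2 : ℝ)) atTop (𝓝 0) := by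
    simpa using ((hnear'.const_mul L).add (hcen.const_mul |H τ|)).add
      (htail.const_mul ((∫ u, g u ^ 2) ^ (1 / 2 : ℝ)))
  rw [tendsto_iff_norm_sub_tendsto_zero]
  refine squeeze_zero' (Eventually.of_forall fun Δ => norm_nonneg _) ?_ hbound
  filter_upwards [hpos] with Δ hΔ
  have hKcΔ := hKc Δ hΔ
  have hgK : Integrable fun u => g u * K Δ u := hg2.integrable_mul (hK2 Δ hΔ)
  have hswap : ∫ s, H s * K Δ (τ - s) = ∫ u, g u * K Δ u := by
    rw [← integral_sub_left_eq_self (fun u => g u * K Δ u) volume τ]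
    simp [hg]
  have hin : ∫ u in Icc (-δ) δ, g u * K Δ u =
      (∫ u in Icc (-δ) δ, (g u - H τ) * K Δ u) + H τ * ∫ u in Icc (-δ) δ, K Δ u := by
    rw [← integral_const_mul, ← integral_add (Continuous.integrableOn_Icc (by fun_prop))
      (Continuous.integrableOn_Icc (by fun_prop))]
    congr 1 with u
    ring
  have hKin : ∫ u in Icc (-δ) δ, K Δ u = (∫ u, K Δ u) - 2 * ∫ u in Ioi δ, K Δ u := by
    rw [← setIntegral_compl_Icc_of_even (hKi Δ hΔ) (hKe Δ hΔ) hδ,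
      ← integral_add_compl (measurableSet_Icc (a := -δ) (b := δ)) (hKi Δ hΔ)]
    ring
  have h1 := abs_setIntegral_Icc_sub_mul_le (α := α) (δ := δ) (L := L) (h := H τ) hgc hKcΔ hα.le
    (fun u hu => by
      have h := hlip (τ - u) τ (by
        rw [sub_sub_cancel_left, abs_neg]
        have := min_le_right δ₁ (δ₂ / 2)
        exact (abs_le.2 hu).trans_lt (by linarith))
      rwa [sub_sub_cancel_left, abs_neg] at h)
  have h2 := abs_setIntegral_mul_le hg2 (hK2 Δ hΔ) (Icc (-δ) δ)ᶜ
  rw [setIntegral_compl_Icc_of_even (hK2 Δ hΔ).integrable_sq (fun u => by rw [hKe Δ hΔ]) hδ] at h2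
  rw [hswap, ← integral_add_compl (measurableSet_Icc (a := -δ) (b := δ)) hgK, hin, hKin,
    Real.norm_eq_abs]
  have h3 : (∫ u in Icc (-δ) δ, (g u - H τ) * K Δ u) +
        H τ * ((∫ u, K Δ u) - 2 * ∫ u in Ioi δ, K Δ u) +
        (∫ u in (Icc (-δ) δ)ᶜ, g u * K Δ u) - c * H τ =
      (∫ u in Icc (-δ) δ, (g u - H τ) * K Δ u) +
        H τ * ((∫ u, K Δ u) - 2 * (∫ u in Ioi δ, K Δ u) - c) +
        ∫ u in (Icc (-δ) δ)ᶜ, g u * K Δ u := by ring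
  rw [h3]
  refine (abs_add_three _ _ _).trans ?_
  rw [abs_mul (H τ)]
  gcongr

/-! ### Mean-square integrals as Bochner integrals -/

section Riemann

variable {a b : ℝ}

theorem TaggedPartition.node_mono (π : TaggedPartition a b) :
    ∀ {i j}, i ≤ j → j ≤ π.n → π.node i ≤ π.node j := by
  intro i j hij
  induction hij with
  | refl => exact fun _ => le_rfl
  | @step k _ ih =>
    intro hk
    have hm := π.tag_mem k hk
    exact (ih (Nat.le_of_succ_le hk)).trans (hm.1.trans hm.2)

theorem TaggedPartition.node_mem (π : TaggedPartition a b) {i : ℕ} (hi : i ≤ π.n) :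
    π.node i ∈ Icc a b :=
  ⟨by simpa [π.node_zero] using π.node_mono (Nat.zero_le i) hi,
    by simpa [π.node_last] using π.node_mono hi le_rfl⟩

/-- The partition of `[a, b]` into `n + 1` equal parts. -/
noncomputable def uniformPartition (hab : a ≤ b) (n : ℕ) : TaggedPartition a b where
  n := n + 1
  node i := a + i * ((b - a) / (n + 1))
  tag i := a + i * ((b - a) / (n + 1))
  node_zero := by simp
  node_last := by push_cast; field_simp; ring
  tag_mem i _ := by
    have h : 0 ≤ (b - a) / ((n : ℝ) + 1) := div_nonneg (sub_nonneg.2 hab) (by positivity)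
    refine ⟨le_rfl, ?_⟩
    push_cast
    linarith

/-- Without arbitrarily fine partitions the limit in `HasMSIntegral` would be vacuous; uniqueness of
the integral rests on this. -/
theorem exists_finerThan (hab : a ≤ b) {δ : ℝ} (hδ : 0 < δ) :
    ∃ π : TaggedPartition a b, π.FinerThan δ := by
  obtain ⟨n, hn⟩ := exists_nat_gt ((b - a) / δ)
  refine ⟨uniformPartition hab n, fun i _ => ?_⟩
  have h : (b - a) / ((n : ℝ) + 1) < δ := by
    rw [div_lt_iff₀ (by positivity)]
    rw [div_lt_iff₀ hδ] at hn
    nlinarith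
  simp only [uniformPartition]
  push_cast
  linarith

theorem norm_riemannSum_sub_integral_le {V : Type*} [NormedAddCommGroup V] [NormedSpace ℝ V]
    [CompleteSpace V] {z : ℝ → V} (hz : Continuous z) (hab : a ≤ b) {ε : ℝ} (hε : 0 < ε) :
    ∃ δ > (0 : ℝ), ∀ π : TaggedPartition a b, π.FinerThan δ →
      ‖(∑ i ∈ Finset.range π.n, (π.node (i + 1) - π.node i) • z (π.tag i)) -
        ∫ t in a..b, z t‖ ≤ ε := by
  -- The summand `1` covers the degenerate interval `a = b`.
  have hε' : 0 < ε / (b - a + 1) := div_pos hε (by linarith)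
  obtain ⟨δ, hδ, hu⟩ := Metric.uniformContinuousOn_iff.1
    (isCompact_Icc.uniformContinuousOn_of_continuous (hz.continuousOn (s := Icc a b))) _ hε'
  refine ⟨δ, hδ, fun π hπ => ?_⟩
  have hint : ∀ c d, IntervalIntegrable z volume c d := fun c d => hz.intervalIntegrable c d
  have hsum := intervalIntegral.sum_integral_adjacent_intervals (a := π.node) (n := π.n)
    (f := z) (μ := volume) fun k _ => hint _ _
  rw [π.node_zero, π.node_last] at hsum
  rw [← hsum, ← Finset.sum_sub_distrib]
  calc _ ≤ ∑ i ∈ Finset.range π.n, ε / (b - a + 1) * (π.node (i + 1) - π.node i) := by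
        refine norm_sum_le_of_le _ fun i hi => ?_
        have hin := Finset.mem_range.1 hi
        have hle := π.node_mono i.le_succ hin
        have htag := π.tag_mem i hin
        have h0 := π.node_mem hin.le
        have h1 := π.node_mem (Nat.succ_le_of_lt hin)
        rw [← intervalIntegral.integral_const, ← intervalIntegral.integral_sub
          intervalIntegrable_const (hint _ _), ← abs_of_nonneg (sub_nonneg.2 hle)]
        refine intervalIntegral.norm_integral_le_of_norm_le_const fun t ht => ?_
        rw [uIoc_of_le hle] at ht
        rw [← dist_eq_norm]
        refine (hu _ ⟨h0.1.trans htag.1, htag.2.trans h1.2⟩ _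
          ⟨h0.1.trans ht.1.le, ht.2.trans h1.2⟩ ?_).le
        refine lt_of_le_of_lt ?_ (hπ i hin)
        rw [Real.dist_eq, abs_le]
        constructor <;> linarith [htag.1, htag.2, ht.1, ht.2]
    _ = ε / (b - a + 1) * (b - a) := by
        rw [← Finset.mul_sum, Finset.sum_range_sub, π.node_zero, π.node_last]
    _ ≤ ε := by
        rw [div_mul_eq_mul_div, div_le_iff₀ (by linarith)]
        nlinarith

variable {Ω : Type*} [MeasurableSpace Ω] {P : Measure Ω} {Z : ℝ → Ω → ℝ} {z : ℝ → Lp ℝ 2 P}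

theorem riemannSum_ae_eq (hZ : ∀ t, Z t =ᵐ[P] z t) (π : TaggedPartition a b) :
    riemannSum Z π =ᵐ[P]
      (∑ i ∈ Finset.range π.n, (π.node (i + 1) - π.node i) • z (π.tag i) : Lp ℝ 2 P) := by
  have h1 := Lp.coeFn_finsetSum (Finset.range π.n)
    (fun i => (π.node (i + 1) - π.node i) • z (π.tag i))
  have h2 : ∀ᵐ ω ∂P, ∀ i : ℕ, ((π.node (i + 1) - π.node i) • z (π.tag i) : Lp ℝ 2 P) ω =
      (π.node (i + 1) - π.node i) * Z (π.tag i) ω := by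
    refine ae_all_iff.2 fun i => ?_
    filter_upwards [Lp.coeFn_smul (π.node (i + 1) - π.node i) (z (π.tag i)), hZ (π.tag i)]
      with ω h3 h4
    rw [h3, h4, Pi.smul_apply, smul_eq_mul]
  filter_upwards [h1, h2] with ω h3 h4
  rw [h3, riemannSum]
  simp only [Finset.sum_apply, h4]

theorem eLpNorm_sub_eq_enorm {U W : Ω → ℝ} {u w : Lp ℝ 2 P} (hU : U =ᵐ[P] u) (hW : W =ᵐ[P] w) :
    eLpNorm (fun ω => U ω - W ω) 2 P = ‖u - w‖ₑ := by
  rw [Lp.enorm_def]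
  refine eLpNorm_congr_ae ?_
  filter_upwards [hU, hW, Lp.coeFn_sub u w] with ω h1 h2 h3
  rw [h1, h2, h3, Pi.sub_apply]

theorem hasMSIntegral_of_ae_eq (hz : Continuous z) (hZ : ∀ t, Z t =ᵐ[P] z t) (hab : a ≤ b)
    {I : Ω → ℝ} (hI : I =ᵐ[P] (∫ t in a..b, z t : Lp ℝ 2 P)) : HasMSIntegral P Z a b I where
  le := hab
  memLp_integrand t _ := (memLp_congr_ae (hZ t)).2 (Lp.memLp _)
  memLp := (memLp_congr_ae hI).2 (Lp.memLp _)
  limit ε hε := by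
    obtain ⟨δ, hδ, h⟩ := norm_riemannSum_sub_integral_le hz hab hε
    refine ⟨δ, hδ, fun π hπ => ?_⟩
    rw [eLpNorm_sub_eq_enorm (riemannSum_ae_eq hZ π) hI, ← ofReal_norm]
    exact ENNReal.ofReal_le_ofReal (h π hπ)

/-- `msIntegral` is an arbitrary choice among integrals, so it must be identified: one Riemann sum
on a sufficiently fine partition is close to both candidates. -/
theorem HasMSIntegral.ae_eq {I : Ω → ℝ} (h : HasMSIntegral P Z a b I) (hz : Continuous z)
    (hZ : ∀ t, Z t =ᵐ[P] z t) : I =ᵐ[P] (∫ t in a..b, z t : Lp ℝ 2 P) := by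
  have hI : I =ᵐ[P] h.memLp.toLp I := h.memLp.coeFn_toLp.symm
  suffices h.memLp.toLp I = ∫ t in a..b, z t by rwa [← this]
  refine eq_of_forall_dist_le fun ε hε => ?_
  obtain ⟨δ₁, hδ₁, h1⟩ := norm_riemannSum_sub_integral_le hz h.le (half_pos hε)
  obtain ⟨δ₂, hδ₂, h2⟩ := h.limit _ (half_pos hε)
  obtain ⟨π, hπ⟩ := exists_finerThan h.le (lt_min hδ₁ hδ₂)
  have h3 := h1 π fun i hi => (hπ i hi).trans_le (min_le_left _ _)
  have h4 := h2 π fun i hi => (hπ i hi).trans_le (min_le_right _ _)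
  rw [eLpNorm_sub_eq_enorm (riemannSum_ae_eq hZ π) hI, ← ofReal_norm,
    ENNReal.ofReal_le_ofReal_iff (half_pos hε).le, norm_sub_rev, ← dist_eq_norm] at h4
  rw [← dist_eq_norm] at h3
  linarith [dist_triangle (h.memLp.toLp I)
    (∑ i ∈ Finset.range π.n, (π.node (i + 1) - π.node i) • z (π.tag i) : Lp ℝ 2 P)
    (∫ t in a..b, z t)]

theorem hasMSIntegralLine_of_tendsto (hz : Continuous z) (hZ : ∀ t, Z t =ᵐ[P] z t)
    {w : Lp ℝ 2 P}
    (hw : Tendsto (fun p : ℝ × ℝ => ∫ t in p.1..p.2, z t) (atBot ×ˢ atTop) (𝓝 w)) :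
    HasMSIntegralLine P Z w where
  memLp := Lp.memLp w
  limit := by
    refine ⟨fun a b => (∫ t in a..b, z t : Lp ℝ 2 P), fun a b hab =>
      hasMSIntegral_of_ae_eq hz hZ hab (ae_eq_refl _), ?_⟩
    simp only [eLpNorm_sub_eq_enorm (ae_eq_refl _) (ae_eq_refl _), ← edist_eq_enorm_sub]
    exact tendsto_iff_edist_tendsto_0.1 hw

theorem HasMSIntegralLine.ae_eq {I : Ω → ℝ} (h : HasMSIntegralLine P Z I) (hz : Continuous z)
    (hZ : ∀ t, Z t =ᵐ[P] z t) {w : Lp ℝ 2 P}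
    (hw : Tendsto (fun p : ℝ × ℝ => ∫ t in p.1..p.2, z t) (atBot ×ˢ atTop) (𝓝 w)) :
    I =ᵐ[P] w := by
  have hI : I =ᵐ[P] h.memLp.toLp I := h.memLp.coeFn_toLp.symm
  suffices h.memLp.toLp I = w by rwa [← this]
  obtain ⟨J, hJ, hlim⟩ := h.limit
  refine tendsto_nhds_unique (tendsto_iff_edist_tendsto_0.2 ?_) hw
  refine hlim.congr' ?_
  filter_upwards [eventually_fst_le_snd] with p hp
  rw [eLpNorm_sub_eq_enorm ((hJ p.1 p.2 hp).ae_eq hz hZ) hI, edist_eq_enorm_sub]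

theorem hasMSIntegral_msIntegral (hz : Continuous z) (hZ : ∀ t, Z t =ᵐ[P] z t) (hab : a ≤ b) :
    HasMSIntegral P Z a b (msIntegral P Z a b) := by
  have h : ∃ I, HasMSIntegral P Z a b I := ⟨_, hasMSIntegral_of_ae_eq hz hZ hab (ae_eq_refl _)⟩
  rw [msIntegral, dif_pos h]
  exact h.choose_spec

theorem hasMSIntegralLine_msIntegralLine (hz : Continuous z) (hZ : ∀ t, Z t =ᵐ[P] z t)
    {w : Lp ℝ 2 P}
    (hw : Tendsto (fun p : ℝ × ℝ => ∫ t in p.1..p.2, z t) (atBot ×ˢ atTop) (𝓝 w)) :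
    HasMSIntegralLine P Z (msIntegralLine P Z) := by
  have h : ∃ I, HasMSIntegralLine P Z I := ⟨_, hasMSIntegralLine_of_tendsto hz hZ hw⟩
  rw [msIntegralLine, dif_pos h]
  exact h.choose_spec

end Riemann

/-! ### Gaussian Hilbert spaces -/

/-- Differentiation acts on the polynomial factor by `p ↦ p' + v t p`. Four applications to `1` give
the fourth moment from the Gaussian moment generating function. -/
theorem hasDerivAt_mul_exp_sq {p : ℝ → ℝ} {p' : ℝ} (v t : ℝ) (hp : HasDerivAt p p' t) :
    HasDerivAt (fun s => p s * Real.exp (v * s ^ 2 / 2))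
      ((p' + p t * (v * t)) * Real.exp (v * t ^ 2 / 2)) t := by
  have h := hp.mul ((((hasDerivAt_pow 2 t).const_mul v).div_const 2).exp)
  refine h.congr_deriv ?_
  simp
  ring

open scoped NNReal in
theorem integral_pow_four_gaussianReal (v : ℝ≥0) :
    ∫ x, x ^ 4 ∂(gaussianReal 0 v) = 3 * (v : ℝ) ^ 2 := by
  have h := iteratedDeriv_mgf_zero (X := id) (μ := gaussianReal 0 v)
    (by rw [integrableExpSet_id_gaussianReal]; simp) 4
  simp only [Pi.pow_apply, id] at h
  rw [← h, mgf_id_gaussianReal]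
  simp only [zero_mul, zero_add]
  have d1 : deriv (fun t : ℝ => Real.exp (v * t ^ 2 / 2)) =
      fun t => (v * t) * Real.exp (v * t ^ 2 / 2) := funext fun t => by
    have := (hasDerivAt_mul_exp_sq v t (hasDerivAt_const t (1 : ℝ))).deriv
    simpa using this
  have d2 : deriv (fun t : ℝ => (v * t) * Real.exp (v * t ^ 2 / 2)) =
      fun t => (v + v ^ 2 * t ^ 2) * Real.exp (v * t ^ 2 / 2) := funext fun t => by
    rw [(hasDerivAt_mul_exp_sq v t ((hasDerivAt_id' t).const_mul (v : ℝ))).deriv]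
    ring
  have d3 : deriv (fun t : ℝ => (v + v ^ 2 * t ^ 2) * Real.exp (v * t ^ 2 / 2)) =
      fun t => (3 * v ^ 2 * t + v ^ 3 * t ^ 3) * Real.exp (v * t ^ 2 / 2) := funext fun t => by
    rw [(hasDerivAt_mul_exp_sq v t
      (((hasDerivAt_pow 2 t).const_mul ((v : ℝ) ^ 2)).const_add (v : ℝ))).deriv]
    simp
    ring
  have d4 : deriv (fun t : ℝ => (3 * v ^ 2 * t + v ^ 3 * t ^ 3) * Real.exp (v * t ^ 2 / 2)) 0 =
      3 * (v : ℝ) ^ 2 := by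
    rw [(hasDerivAt_mul_exp_sq v 0 (((hasDerivAt_id' (0 : ℝ)).const_mul (3 * (v : ℝ) ^ 2)).fun_add
      ((hasDerivAt_pow 3 (0 : ℝ)).const_mul ((v : ℝ) ^ 3)))).deriv]
    simp
  simp only [iteratedDeriv_succ, iteratedDeriv_zero, d1, d2, d3, d4]

section GaussianSpace

variable {Ω : Type*} [MeasurableSpace Ω] {P : Measure Ω}

/-- The map is Lipschitz with constant `|t|`, by `|exp(ia) - exp(ib)| ≤ |a - b|` and the comparison
of `L¹` and `L²` norms under a probability measure. -/
theorem continuous_integral_exp_coe [IsProbabilityMeasure P] (t : ℝ) :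
    Continuous fun u : Lp ℝ 2 P => ∫ ω, Complex.exp (t * (u ω : ℝ) * Complex.I) ∂P := by
  have hint : ∀ u : Lp ℝ 2 P, Integrable (fun ω => Complex.exp (t * (u ω : ℝ) * Complex.I)) P := by
    intro u
    have hm := (Lp.aestronglyMeasurable u).aemeasurable
    refine Integrable.of_bound (C := 1) (AEMeasurable.aestronglyMeasurable (by fun_prop))
      (Eventually.of_forall fun ω => ?_)
    rw [← Complex.ofReal_mul, Complex.norm_exp_ofReal_mul_I]
  refine LipschitzWith.continuous (K := ‖t‖₊) (LipschitzWith.of_dist_le_mul fun u w => ?_)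
  rw [dist_eq_norm, ← integral_sub (hint u) (hint w), dist_eq_norm]
  have h2 : MemLp (fun ω => (u - w : Lp ℝ 2 P) ω) 2 P := Lp.memLp _
  calc _ ≤ ∫ ω, ‖t‖ * ‖(u - w : Lp ℝ 2 P) ω‖ ∂P := by
        refine norm_integral_le_of_norm_le ((h2.integrable one_le_two).norm.const_mul _) ?_
        filter_upwards [Lp.coeFn_sub u w] with ω hω
        rw [hω, Pi.sub_apply, ← norm_mul, mul_sub, ← Complex.ofReal_mul, ← Complex.ofReal_mul,
          mul_comm _ Complex.I, mul_comm _ Complex.I]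
        have h := Real.norm_exp_I_mul_ofReal_sub_one_le (x := t * u ω - t * w ω)
        have he : Complex.exp (Complex.I * ((t * u ω : ℝ) : ℂ)) -
            Complex.exp (Complex.I * ((t * w ω : ℝ) : ℂ)) =
            Complex.exp (((t * w ω : ℝ) : ℂ) * Complex.I) *
              (Complex.exp (Complex.I * ((t * u ω - t * w ω : ℝ) : ℂ)) - 1) := by
          rw [mul_sub, ← Complex.exp_add, mul_one]
          congr 2
          · push_cast; ring
          · push_cast; ring
        rw [he, norm_mul, Complex.norm_exp_ofReal_mul_I, one_mul]
        exact h
    _ = ‖t‖ * ∫ ω, ‖(u - w : Lp ℝ 2 P) ω‖ ∂P := integral_const_mul _ _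
    _ ≤ ‖t‖ * ‖u - w‖ := by
        refine mul_le_mul_of_nonneg_left ?_ (norm_nonneg _)
        rw [integral_norm_eq_lintegral_enorm h2.aestronglyMeasurable, Lp.norm_def,
          ← eLpNorm_one_eq_lintegral_enorm]
        exact ENNReal.toReal_mono h2.eLpNorm_ne_top
          (eLpNorm_le_eLpNorm_of_exponent_le one_le_two h2.aestronglyMeasurable)

/-- The law of a square-integrable random variable is centered Gaussian. -/
def IsCenteredGaussian (u : Lp ℝ 2 P) : Prop :=
  P.map u = gaussianReal 0 (‖u‖₊ ^ 2)

/-- Characteristic functions turn Gaussianity into a family of equations between continuous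
functions of `u`, hence into a closed condition. -/
theorem isCenteredGaussian_iff [IsProbabilityMeasure P] (u : Lp ℝ 2 P) :
    IsCenteredGaussian u ↔ ∀ t : ℝ, ∫ ω, Complex.exp (t * (u ω : ℝ) * Complex.I) ∂P =
      Complex.exp (-(‖u‖ : ℂ) ^ 2 * t ^ 2 / 2) := by
  have hm := (Lp.aestronglyMeasurable u).aemeasurable
  have h1 : ∀ t : ℝ, charFun (P.map u) t = ∫ ω, Complex.exp (t * (u ω : ℝ) * Complex.I) ∂P := by
    intro t
    rw [charFun_apply_real, integral_map hm (by fun_prop)]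
  have h2 : ∀ t : ℝ, charFun (gaussianReal 0 (‖u‖₊ ^ 2)) t =
      Complex.exp (-(‖u‖ : ℂ) ^ 2 * t ^ 2 / 2) := by
    intro t
    rw [charFun_gaussianReal]
    congr 1
    push_cast
    ring
  have : IsProbabilityMeasure (P.map u) := Measure.isProbabilityMeasure_map hm
  refine ⟨fun h t => ?_, fun h => Measure.ext_of_charFun (funext fun t => ?_)⟩
  · rw [← h1, ← h2, h]
  · rw [h1, h2, h]

theorem isClosed_isCenteredGaussian [IsProbabilityMeasure P] :
    IsClosed {u : Lp ℝ 2 P | IsCenteredGaussian u} := by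
  simp only [isCenteredGaussian_iff, ofPred_forall]
  exact isClosed_iInter fun t => isClosed_eq (continuous_integral_exp_coe t) (by fun_prop)

theorem inner_eq_integral_mul (u w : Lp ℝ 2 P) : inner ℝ u w = ∫ ω, u ω * w ω ∂P := by
  rw [L2.inner_def]
  congr 1 with ω
  simp [mul_comm]

theorem inner_eq_integral_of_ae_eq {u w : Lp ℝ 2 P} {U W : Ω → ℝ} (hU : U =ᵐ[P] u)
    (hW : W =ᵐ[P] w) : inner ℝ u w = ∫ ω, U ω * W ω ∂P := by
  rw [inner_eq_integral_mul]
  refine integral_congr_ae ?_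
  filter_upwards [hU, hW] with ω h1 h2
  rw [h1, h2]

theorem isCenteredGaussian_of_hasGaussianLaw {u : Lp ℝ 2 P} {U : Ω → ℝ} (hU : U =ᵐ[P] u)
    (hg : HasGaussianLaw U P) (h0 : ∫ ω, U ω ∂P = 0) : IsCenteredGaussian u := by
  have hv : Var[U; P] = ‖u‖ ^ 2 := by
    rw [variance_of_integral_eq_zero hg.aemeasurable h0, ← real_inner_self_eq_norm_sq,
      inner_eq_integral_of_ae_eq hU hU]
    simp only [sq]
  rw [IsCenteredGaussian, ← Measure.map_congr hU, hg.map_eq_gaussianReal, h0, hv]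
  congr 1
  ext
  simp

theorem isCenteredGaussian_of_mem_closure_span [IsProbabilityMeasure P] {X : ℝ → Ω → ℝ}
    (hX : IsGaussianProcess X P)
    (h0 : ∀ t, ∫ ω, X t ω ∂P = 0) {x : ℝ → Lp ℝ 2 P} (hx : ∀ t, X t =ᵐ[P] x t) {u : Lp ℝ 2 P}
    (hu : u ∈ (Submodule.span ℝ (range x)).topologicalClosure) : IsCenteredGaussian u := by
  refine closure_minimal ?_ isClosed_isCenteredGaussian hu
  intro w hw
  obtain ⟨c, rfl⟩ := Finsupp.mem_span_range_iff_exists_finsupp.1 hw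
  have hi : ∀ t, Integrable (X t) P := fun t => (hX.hasGaussianLaw_eval t).integrable
  refine isCenteredGaussian_of_hasGaussianLaw (U := fun ω => ∑ t ∈ c.support, c t • X t ω) ?_
    (hX.smul c).hasGaussianLaw_fun_sum ?_
  · have h1 := Lp.coeFn_finsetSum c.support (fun t => c t • x t)
    have h2 : ∀ᵐ ω ∂P, ∀ t ∈ c.support, (c t • x t : Lp ℝ 2 P) ω = c t • X t ω := by
      refine (Finset.eventually_all _).2 fun t _ => ?_
      filter_upwards [Lp.coeFn_smul (c t) (x t), hx t] with ω h3 h4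
      rw [h3, h4, Pi.smul_apply]
    filter_upwards [h1, h2] with ω h3 h4
    rw [Finsupp.sum, h3, Finset.sum_apply]
    exact Finset.sum_congr rfl fun t ht => (h4 t ht).symm
  · rw [integral_finsetSum (f := fun t ω => c t • X t ω) _ fun t _ => (hi t).smul (c t)]
    simp [integral_const_mul, h0]

theorem IsCenteredGaussian.memLp_four {u : Lp ℝ 2 P} (hu : IsCenteredGaussian u) :
    MemLp u 4 P := by
  have hm := (Lp.aestronglyMeasurable u).aemeasurable
  have h := memLp_id_gaussianReal' (μ := 0) (v := ‖u‖₊ ^ 2) 4 (by norm_num)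
  rw [← hu, memLp_map_measure_iff aestronglyMeasurable_id hm] at h
  exact h

theorem IsCenteredGaussian.integral_pow_four {u : Lp ℝ 2 P} (hu : IsCenteredGaussian u) :
    ∫ ω, u ω ^ 4 ∂P = 3 * (inner ℝ u u) ^ 2 := by
  have hm := (Lp.aestronglyMeasurable u).aemeasurable
  have h := integral_pow_four_gaussianReal (‖u‖₊ ^ 2)
  rw [← hu, integral_map hm (by fun_prop)] at h
  rw [h, real_inner_self_eq_norm_sq]
  simp

theorem IsCenteredGaussian.integrable_pow_four {u : Lp ℝ 2 P} (hu : IsCenteredGaussian u) :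
    Integrable (fun ω => u ω ^ 4) P := by
  have h := hu.memLp_four.integrable_norm_pow (p := 4) (by norm_num)
  refine h.congr (Eventually.of_forall fun ω => ?_)
  simp only [Real.norm_eq_abs]
  rw [← abs_pow, abs_of_nonneg (by positivity)]

/-- **Wick's formula** for four elements of a Gaussian Hilbert space. -/
theorem integral_mul_four {S : Submodule ℝ (Lp ℝ 2 P)} (hS : ∀ u ∈ S, IsCenteredGaussian u)
    {u₁ u₂ u₃ u₄ : Lp ℝ 2 P} (h₁ : u₁ ∈ S) (h₂ : u₂ ∈ S) (h₃ : u₃ ∈ S) (h₄ : u₄ ∈ S) :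
    ∫ ω, (u₁ ω * u₂ ω) * (u₃ ω * u₄ ω) ∂P =
      inner ℝ u₁ u₂ * inner ℝ u₃ u₄ + inner ℝ u₁ u₃ * inner ℝ u₂ u₄ +
        inner ℝ u₁ u₄ * inner ℝ u₂ u₃ := by
  -- Polarization: the fourth moment of each combination is known, since `S` is a subspace.
  have key : ∀ e₂ e₃ e₄ : ℝ,
      Integrable (fun ω => (u₁ ω + e₂ * u₂ ω + e₃ * u₃ ω + e₄ * u₄ ω) ^ 4) P ∧
      ∫ ω, (u₁ ω + e₂ * u₂ ω + e₃ * u₃ ω + e₄ * u₄ ω) ^ 4 ∂P =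
        3 * (inner ℝ u₁ u₁ + e₂ ^ 2 * inner ℝ u₂ u₂ + e₃ ^ 2 * inner ℝ u₃ u₃ +
          e₄ ^ 2 * inner ℝ u₄ u₄ + 2 * (e₂ * inner ℝ u₁ u₂ + e₃ * inner ℝ u₁ u₃ +
          e₄ * inner ℝ u₁ u₄ + e₂ * e₃ * inner ℝ u₂ u₃ + e₂ * e₄ * inner ℝ u₂ u₄ +
          e₃ * e₄ * inner ℝ u₃ u₄)) ^ 2 := by
    intro e₂ e₃ e₄
    have hw := hS _ (S.add_mem (S.add_mem (S.add_mem h₁ (S.smul_mem e₂ h₂)) (S.smul_mem e₃ h₃))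
      (S.smul_mem e₄ h₄))
    have hae : (fun ω => (u₁ + e₂ • u₂ + e₃ • u₃ + e₄ • u₄ : Lp ℝ 2 P) ω ^ 4) =ᵐ[P]
        fun ω => (u₁ ω + e₂ * u₂ ω + e₃ * u₃ ω + e₄ * u₄ ω) ^ 4 := by
      filter_upwards [Lp.coeFn_add (u₁ + e₂ • u₂ + e₃ • u₃) (e₄ • u₄),
        Lp.coeFn_add (u₁ + e₂ • u₂) (e₃ • u₃), Lp.coeFn_add u₁ (e₂ • u₂),
        Lp.coeFn_smul e₂ u₂, Lp.coeFn_smul e₃ u₃, Lp.coeFn_smul e₄ u₄] with ω a1 a2 a3 a4 a5 a6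
      simp only [a1, a2, a3, a4, a5, a6, Pi.add_apply, Pi.smul_apply, smul_eq_mul]
    refine ⟨hw.integrable_pow_four.congr hae, ?_⟩
    rw [← integral_congr_ae hae, hw.integral_pow_four]
    simp only [inner_add_left, inner_add_right, inner_smul_left, inner_smul_right, conj_trivial,
      real_inner_comm u₁ u₂, real_inner_comm u₁ u₃, real_inner_comm u₁ u₄, real_inner_comm u₂ u₃,
      real_inner_comm u₂ u₄, real_inner_comm u₃ u₄]
    ring
  -- The sum over signs `e₂, e₃, e₄ = ±1` with weight `e₂ e₃ e₄` keeps only the monomial odd in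
  -- `u₂`, `u₃` and `u₄`. Its coefficient is `4! = 24` in each of the `8` terms, and `24 * 8 = 192`.
  have hp : ∀ ω, (u₁ ω * u₂ ω) * (u₃ ω * u₄ ω) = (1 / 192) *
      (((u₁ ω + 1 * u₂ ω + 1 * u₃ ω + 1 * u₄ ω) ^ 4 -
        (u₁ ω + 1 * u₂ ω + 1 * u₃ ω + (-1) * u₄ ω) ^ 4) -
       ((u₁ ω + 1 * u₂ ω + (-1) * u₃ ω + 1 * u₄ ω) ^ 4 -
        (u₁ ω + 1 * u₂ ω + (-1) * u₃ ω + (-1) * u₄ ω) ^ 4) -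
       (((u₁ ω + (-1) * u₂ ω + 1 * u₃ ω + 1 * u₄ ω) ^ 4 -
         (u₁ ω + (-1) * u₂ ω + 1 * u₃ ω + (-1) * u₄ ω) ^ 4) -
       ((u₁ ω + (-1) * u₂ ω + (-1) * u₃ ω + 1 * u₄ ω) ^ 4 -
        (u₁ ω + (-1) * u₂ ω + (-1) * u₃ ω + (-1) * u₄ ω) ^ 4))) := fun ω => by ring
  have hd : ∀ e₂ e₃ : ℝ, Integrable (fun ω => (u₁ ω + e₂ * u₂ ω + e₃ * u₃ ω + 1 * u₄ ω) ^ 4 -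
      (u₁ ω + e₂ * u₂ ω + e₃ * u₃ ω + (-1) * u₄ ω) ^ 4) P :=
    fun e₂ e₃ => (key _ _ _).1.sub (key _ _ _).1
  have hd' : ∀ e₂ : ℝ, Integrable (fun ω => (u₁ ω + e₂ * u₂ ω + 1 * u₃ ω + 1 * u₄ ω) ^ 4 -
      (u₁ ω + e₂ * u₂ ω + 1 * u₃ ω + (-1) * u₄ ω) ^ 4 -
      ((u₁ ω + e₂ * u₂ ω + (-1) * u₃ ω + 1 * u₄ ω) ^ 4 -
      (u₁ ω + e₂ * u₂ ω + (-1) * u₃ ω + (-1) * u₄ ω) ^ 4)) P :=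
    fun e₂ => (hd _ _).sub (hd _ _)
  simp only [hp]
  rw [integral_const_mul, integral_sub (hd' 1) (hd' (-1)), integral_sub (hd 1 1) (hd 1 (-1)),
    integral_sub (hd (-1) 1) (hd (-1) (-1))]
  simp only [integral_sub (key _ _ _).1 (key _ _ _).1, (key _ _ _).2]
  ring

theorem memLp_mul_of_mem {S : Submodule ℝ (Lp ℝ 2 P)} (hS : ∀ u ∈ S, IsCenteredGaussian u)
    {u w : Lp ℝ 2 P} (hu : u ∈ S) (hw : w ∈ S) : MemLp (fun ω => u ω * w ω) 2 P := by
  have : ENNReal.HolderTriple 4 4 2 := ⟨by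
    rw [← ENNReal.toReal_eq_toReal_iff' (by simp) (by simp), ENNReal.toReal_add (by simp) (by simp)]
    norm_num⟩
  exact (hS w hw).memLp_four.mul (hS u hu).memLp_four

end GaussianSpace

/-! ### The estimator for a fixed input process -/

/-- `‖z s - z t‖²` is a combination of values of the Gram kernel. This gives continuity of the input
from `K`, and of the product process from Wick's formula. -/
theorem continuous_of_continuous_inner {V : Type*} [NormedAddCommGroup V] [InnerProductSpace ℝ V]
    {z : ℝ → V} (h : Continuous fun q : ℝ × ℝ => (inner ℝ (z q.1) (z q.2) : ℝ)) :
    Continuous z := by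
  refine continuous_iff_continuousAt.2 fun t => ?_
  rw [ContinuousAt, tendsto_iff_norm_sub_tendsto_zero]
  have h1 : Continuous fun s => √(inner ℝ (z s) (z s) - 2 * inner ℝ (z s) (z t) +
      inner ℝ (z t) (z t)) := by
    have a1 : Continuous fun s => (inner ℝ (z s) (z s) : ℝ) :=
      h.comp (continuous_id.prodMk continuous_id)
    have a2 : Continuous fun s => (inner ℝ (z s) (z t) : ℝ) :=
      h.comp (continuous_id.prodMk continuous_const)
    fun_prop
  have h2 := h1.tendsto t
  rw [show inner ℝ (z t) (z t) - 2 * inner ℝ (z t) (z t) + inner ℝ (z t) (z t) = (0 : ℝ) by ring,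
    Real.sqrt_zero] at h2
  refine h2.congr fun s => ?_
  rw [real_inner_self_eq_norm_sq, real_inner_self_eq_norm_sq, ← norm_sub_sq_real,
    Real.sqrt_sq (norm_nonneg _)]

/-! ### The correlation function as a cosine transform. -/

section Spectral

variable {Ω : Type*} [MeasurableSpace Ω] {P : Measure Ω} {X : ℝ → Ω → ℝ} {f : ℝ → ℝ}

theorem HasSpectralDensity.corr_eq (h : HasSpectralDensity P X f) (t : ℝ) :
    (corr P X t : ℂ) = ∫ l : ℝ, Complex.exp (Complex.I * l * t) * (f l : ℂ) := by
  rw [← h 0 t, zero_add, corr]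

theorem HasSpectralDensity.integral_mul_eq (h : HasSpectralDensity P X f) (s t : ℝ) :
    ∫ ω, X s ω * X t ω ∂P = corr P X (s - t) := by
  have h1 := h t (s - t)
  rw [add_sub_cancel, ← h.corr_eq, Complex.ofReal_inj] at h1
  exact h1

theorem HasSpectralDensity.corr_eq_integral_cos (h : HasSpectralDensity P X f)
    (hf : Integrable f) (t : ℝ) : corr P X t = ∫ l, Real.cos (l * t) * f l := by
  rw [← Complex.ofReal_re (corr P X t), h.corr_eq, ← RCLike.re_eq_complex_re, ← integral_re]
  · congr 1 with l
    rw [show Complex.I * l * t = ((l * t : ℝ) : ℂ) * Complex.I by push_cast; ring,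
      RCLike.re_eq_complex_re, Complex.re_mul_ofReal, Complex.exp_ofReal_mul_I_re]
  · refine hf.ofReal.bdd_mul (c := 1) (Continuous.aestronglyMeasurable (by fun_prop))
      (Eventually.of_forall fun l => ?_)
    rw [show Complex.I * l * t = ((l * t : ℝ) : ℂ) * Complex.I by push_cast; ring,
      Complex.norm_exp_ofReal_mul_I]

theorem HasSpectralDensity.continuous_corr (h : HasSpectralDensity P X f)
    (hf : Integrable f) : Continuous (corr P X) := by
  rw [funext (h.corr_eq_integral_cos hf)]
  refine continuous_of_dominated (bound := fun l => ‖f l‖)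
    (fun t => (Continuous.aestronglyMeasurable (by fun_prop)).mul hf.aestronglyMeasurable)
    (fun t => Eventually.of_forall fun l => ?_) hf.norm
    (Eventually.of_forall fun l => by fun_prop)
  rw [norm_mul]
  exact mul_le_of_le_one_left (norm_nonneg _) (Real.abs_cos_le_one _)

/-- `K` is bounded by `∫ |f|`, and a bounded integrable function is square-integrable. -/
theorem HasSpectralDensity.memLp_corr (h : HasSpectralDensity P X f)
    (hf : Integrable f) (hK : Integrable (corr P X)) : MemLp (corr P X) 2 := by
  have hc := h.continuous_corr hf
  rw [memLp_two_iff_integrable_sq hc.aestronglyMeasurable]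
  simp only [sq]
  refine hK.bdd_mul (c := ∫ l, ‖f l‖) hc.aestronglyMeasurable (Eventually.of_forall fun t => ?_)
  rw [h.corr_eq_integral_cos hf]
  refine norm_integral_le_of_norm_le hf.norm (Eventually.of_forall fun l => ?_)
  rw [norm_mul]
  exact mul_le_of_le_one_left (norm_nonneg _) (Real.abs_cos_le_one _)

end Spectral

section FixedInput

variable {Ω : Type*} [MeasurableSpace Ω] {P : Measure Ω} {X : ℝ → Ω → ℝ} {f : ℝ → ℝ} {M : ℝ}
  {H : ℝ → ℝ}

theorem isSpectralCurve_toLp (hX2 : ∀ t, MemLp (X t) 2 P) (hs : HasSpectralDensity P X f)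
    (hf : Integrable f) (hM : 0 ≤ M) (hfM : ∀ l, f l ≤ M) :
    IsSpectralCurve (fun t => (hX2 t).toLp (X t)) (corr P X) f M := by
  have hin : ∀ s t, inner ℝ ((hX2 s).toLp (X s)) ((hX2 t).toLp (X t)) = corr P X (s - t) := by
    intro s t
    rw [inner_eq_integral_of_ae_eq (hX2 s).coeFn_toLp.symm (hX2 t).coeFn_toLp.symm,
      hs.integral_mul_eq]
  have hc := hs.continuous_corr hf
  refine ⟨continuous_of_continuous_inner ?_, hin, hf, hfM, hM, hs.corr_eq_integral_cos hf⟩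
  simp only [hin]
  fun_prop

variable [IsProbabilityMeasure P]

/-- For a fixed input process, the integrals defining the response and the estimator exist, and the
quadratic error of the estimator is bounded by its squared bias and a variance term. -/
theorem exists_and_quadratic_error_le (hX : IsGaussianProcess X P) (h0 : ∀ t, ∫ ω, X t ω ∂P = 0)
    (hs : HasSpectralDensity P X f) (hf : Integrable f) (hM : 0 ≤ M) (hfM : ∀ l, f l ≤ M)
    (hK : Integrable (corr P X)) (hH : Continuous H) (hH2 : MemLp H 2) :
    (∀ t, HasMSIntegralLine P (fun s ω => H s * X (t - s) ω) (response P H X t)) ∧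
    (∀ T > 0, ∀ τ : ℝ, HasMSIntegral P (fun t ω => response P H X (t + τ) ω * X t ω) 0 T
      (msIntegral P (fun t ω => response P H X (t + τ) ω * X t ω) 0 T)) ∧
    (∀ c > 0, ∀ T > 0, ∀ τ : ℝ, ∫ ω, |estimator P c H X T τ ω - H τ| ^ 2 ∂P ≤
      (1 / c * (∫ s, H s * corr P X (τ - s)) - H τ) ^ 2 +
        4 * Real.pi * M * (2 * Real.pi * M * ∫ s, H s ^ 2) / c ^ 2 * (1 / T)) := by
  have hX2 : ∀ t, MemLp (X t) 2 P := fun t => (hX.hasGaussianLaw_eval t).memLp_two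
  have hx := isSpectralCurve_toLp hX2 hs hf hM hfM
  set x : ℝ → Lp ℝ 2 P := fun t => (hX2 t).toLp (X t) with hxdef
  have hXx : ∀ t, X t =ᵐ[P] x t := fun t => (hX2 t).coeFn_toLp.symm
  have hxc := hx.continuous
  obtain ⟨y, hyc, hy⟩ := hx.exists_response hH hH2.integrable_sq
  have hZ : ∀ t s, (fun ω => H s * X (t - s) ω) =ᵐ[P] (H s • x (t - s) : Lp ℝ 2 P) := by
    intro t s
    filter_upwards [Lp.coeFn_smul (H s) (x (t - s)), hXx (t - s)] with ω h1 h2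
    rw [h1, h2, Pi.smul_apply, smul_eq_mul]
  have hline : ∀ t, HasMSIntegralLine P (fun s ω => H s * X (t - s) ω) (response P H X t) :=
    fun t => hasMSIntegralLine_msIntegralLine (by fun_prop) (hZ t) (hy t)
  have hYy : ∀ t, response P H X t =ᵐ[P] y t := fun t =>
    (hline t).ae_eq (by fun_prop) (hZ t) (hy t)
  set S := (Submodule.span ℝ (range x)).topologicalClosure
  have hS : ∀ u ∈ S, IsCenteredGaussian u := fun u hu =>
    isCenteredGaussian_of_mem_closure_span hX h0 hXx hu
  have hxS : ∀ t, x t ∈ S := fun t =>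
    Submodule.le_topologicalClosure _ (Submodule.subset_span (mem_range_self t))
  have hyS : ∀ t, y t ∈ S := fun t => response_mem_closure_span hxc hH (hy t)
  have hm2 : ∀ τ t, MemLp (fun ω => y (t + τ) ω * x t ω) 2 P := fun τ t =>
    memLp_mul_of_mem hS (hyS _) (hxS _)
  have hzae : ∀ τ t, (fun ω => y (t + τ) ω * x t ω) =ᵐ[P] (hm2 τ t).toLp _ := fun τ t =>
    (hm2 τ t).coeFn_toLp.symm
  have hzz : ∀ τ t s, inner ℝ ((hm2 τ t).toLp _) ((hm2 τ s).toLp _) =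
      inner ℝ (y (t + τ)) (x t) * inner ℝ (y (s + τ)) (x s) +
      inner ℝ (y (t + τ)) (y (s + τ)) * inner ℝ (x t) (x s) +
      inner ℝ (y (t + τ)) (x s) * inner ℝ (x t) (y (s + τ)) := fun τ t s => by
    rw [inner_eq_integral_of_ae_eq (hzae τ t) (hzae τ s),
      integral_mul_four hS (hyS _) (hxS _) (hyS _) (hxS _)]
  have hzc : ∀ τ, Continuous fun t => (hm2 τ t).toLp _ := fun τ =>
    continuous_of_continuous_inner (by simp only [hzz]; fun_prop)
  have hZz : ∀ τ t, (fun ω => response P H X (t + τ) ω * X t ω) =ᵐ[P] (hm2 τ t).toLp _ := by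
    intro τ t
    filter_upwards [hzae τ t, hYy (t + τ), hXx t] with ω h1 h2 h3
    rw [← h1, h2, h3]
  have hint : ∀ T > 0, ∀ τ : ℝ,
      HasMSIntegral P (fun t ω => response P H X (t + τ) ω * X t ω) 0 T
      (msIntegral P (fun t ω => response P H X (t + τ) ω * X t ω) 0 T) := fun T hT τ =>
    hasMSIntegral_msIntegral (hzc τ) (hZz τ) hT.le
  refine ⟨hline, hint, fun c hc T hT τ => ?_⟩
  -- The constant `1` is a unit vector whose inner product with a random variable is its
  -- expectation.
  have he2 : MemLp (fun _ : Ω => (1 : ℝ)) 2 P := memLp_const 1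
  have heae : (fun _ : Ω => (1 : ℝ)) =ᵐ[P] he2.toLp _ := he2.coeFn_toLp.symm
  set e : Lp ℝ 2 P := he2.toLp _
  have he : ‖e‖ = 1 := by
    rw [← pow_eq_one_iff_of_nonneg (norm_nonneg e) two_ne_zero, ← real_inner_self_eq_norm_sq,
      inner_eq_integral_of_ae_eq heae heae]
    simp
  have hmean : ∀ t, inner ℝ (y (t + τ)) (x t) = ∫ s, H s * corr P X (τ - s) := fun t =>
    hx.inner_response_eq hH (hH2.integrable_mul ((hs.memLp_corr hf hK).comp_measurePreserving
      (Measure.measurePreserving_sub_left volume τ))) (hy (t + τ))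
  have hmain := hx.norm_average_sub_sq_le hyc
    (fun t => hx.norm_response_sq_le hH hH2.integrable_sq (hy t)) (hzc τ) he
    (m := ∫ s, H s * corr P X (τ - s)) (τ := τ)
    (fun t => by
      rw [inner_eq_integral_of_ae_eq (hzae τ t) heae, ← hmean t, inner_eq_integral_mul]
      simp only [mul_one])
    (fun t s => by
      rw [hzz, hmean, hmean, hx.inner_eq, real_inner_comm (x t)]
      ring)
    hc hT (H τ)
  refine le_of_eq_of_le ?_ hmain
  set w := (1 / (c * T)) • (∫ t in (0 : ℝ)..T, (hm2 τ t).toLp _) - H τ • e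
  have hw : (fun ω => estimator P c H X T τ ω - H τ) =ᵐ[P] w := by
    filter_upwards [(hint T hT τ).ae_eq (hzc τ) (hZz τ), heae,
      Lp.coeFn_sub ((1 / (c * T)) • (∫ t in (0 : ℝ)..T, (hm2 τ t).toLp _)) (H τ • e),
      Lp.coeFn_smul (1 / (c * T)) (∫ t in (0 : ℝ)..T, (hm2 τ t).toLp _),
      Lp.coeFn_smul (H τ) e] with ω h1 h2 h3 h4 h5
    rw [h3, Pi.sub_apply, h4, h5, Pi.smul_apply, Pi.smul_apply, ← h1, ← h2, estimator]
    simp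
  rw [← real_inner_self_eq_norm_sq, inner_eq_integral_of_ae_eq hw hw]
  simp only [sq_abs]
  simp only [sq]

end FixedInput

theorem IsLip.continuous {α : ℝ} (hα : 0 < α) {H : ℝ → ℝ} (h : IsLip α H) : Continuous H := by
  obtain ⟨δ, hδ, L, _, hL⟩ := h
  refine continuous_iff_continuousAt.2 fun t => ?_
  rw [ContinuousAt, tendsto_iff_norm_sub_tendsto_zero]
  have h1 : Continuous fun s : ℝ => L * |s - t| ^ α :=
    ((continuous_id.sub continuous_const).abs.rpow_const fun _ => Or.inr hα.le).const_mul L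
  have h2 := h1.tendsto t
  rw [sub_self, abs_zero, Real.zero_rpow hα.ne', mul_zero] at h2
  refine squeeze_zero' (Eventually.of_forall fun s => norm_nonneg _) ?_ h2
  filter_upwards [Metric.ball_mem_nhds t hδ] with s hs
  exact hL s t hs

end Correlogram

/-! ### Passage to the limit in `T` and `Δ`. -/

theorem mainTheorem11 {Ω : Type*} [MeasurableSpace Ω] (P : Measure Ω) [IsProbabilityMeasure P]
    (X : ℝ → ℝ → Ω → ℝ) (f : ℝ → ℝ → ℝ) (c : ℝ)
    (hX : Correlogram.IsInputFamily P X f c)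
    (α : ℝ) (hα : α ∈ Set.Ioc (0 : ℝ) 1)
    (hK : Correlogram.BalanceConditions (fun Δ => Correlogram.corr P (X Δ)) α)
    (H : ℝ → ℝ) (hHLip : Correlogram.IsLip α H) (hHL2 : MemLp H 2 volume) :
    -- the mean-square integrals defining the response and the estimator exist
    (∀ Δ > 0, ∀ t : ℝ,
      Correlogram.HasMSIntegralLine P (fun s ω => H s * X Δ (t - s) ω)
        (Correlogram.response P H (X Δ) t)) ∧
    (∀ T > 0, ∀ Δ > 0, ∀ τ : ℝ,
      Correlogram.HasMSIntegral P
        (fun t ω => Correlogram.response P H (X Δ) (t + τ) ω * X Δ t ω) 0 T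
        (Correlogram.msIntegral P
          (fun t ω => Correlogram.response P H (X Δ) (t + τ) ω * X Δ t ω) 0 T)) ∧
    -- mean-square consistency at every point
    (∀ τ : ℝ,
      Tendsto
        (fun p : ℝ × ℝ => ∫ ω, |Correlogram.estimator P c H (X p.2) p.1 τ ω - H τ| ^ 2 ∂P)
        (atTop ×ˢ atTop) (𝓝 0)) := by
  obtain ⟨M, hM⟩ := hX.bounded
  have hM0 : 0 ≤ M := (abs_nonneg _).trans (hM 1 one_pos 0)
  have hHc : Continuous H := hHLip.continuous hα.1
  have key := fun Δ (hΔ : Δ > 0) => Correlogram.exists_and_quadratic_error_le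
    (hX.gaussian Δ hΔ) (hX.centered Δ hΔ) (hX.spectral Δ hΔ) (hX.integrable Δ hΔ) hM0
    (fun l => (le_abs_self _).trans (hM Δ hΔ l)) (hX.corr_integrable Δ hΔ) hHc hHL2
  refine ⟨fun Δ hΔ => (key Δ hΔ).1, fun T hT Δ hΔ => (key Δ hΔ).2.1 T hT, fun τ => ?_⟩
  have hf0 : Tendsto (fun Δ => f Δ 0) atTop (𝓝 (c / (2 * Real.pi))) :=
    (hX.tendsto 1 one_pos).tendsto_at (by simp)
  have hKt : Tendsto (fun Δ => ∫ u, Correlogram.corr P (X Δ) u) atTop (𝓝 c) := by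
    have h := hf0.const_mul (2 * Real.pi)
    rw [mul_div_cancel₀ c Real.two_pi_pos.ne'] at h
    refine h.congr' ?_
    filter_upwards [eventually_gt_atTop 0] with Δ hΔ
    exact (Correlogram.integral_eq_two_pi_mul_spectral_density (hX.continuous Δ hΔ)
      (hX.integrable Δ hΔ) (hX.corr_integrable Δ hΔ) (hX.spectral Δ hΔ).corr_eq).symm
  have hbias := Correlogram.tendsto_integral_mul_corr hα.1 hK hX.corr_integrable
    (fun Δ hΔ => (hX.spectral Δ hΔ).continuous_corr (hX.integrable Δ hΔ))
    (fun Δ hΔ => (hX.spectral Δ hΔ).memLp_corr (hX.integrable Δ hΔ) (hX.corr_integrable Δ hΔ))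
    (fun Δ hΔ u => by
      simp only [(hX.spectral Δ hΔ).corr_eq_integral_cos (hX.integrable Δ hΔ), mul_neg,
        Real.cos_neg])
    hKt hHc hHLip hHL2 τ
  have hbias' : Tendsto (fun Δ =>
      (1 / c * (∫ s, H s * Correlogram.corr P (X Δ) (τ - s)) - H τ) ^ 2) atTop (𝓝 0) := by
    have h := ((hbias.const_mul (1 / c)).sub_const (H τ)).pow 2
    rwa [← mul_assoc, one_div_mul_cancel hX.c_pos.ne', one_mul, sub_self, zero_pow two_ne_zero] at h
  have hvar : Tendsto (fun T : ℝ => 4 * Real.pi * M * (2 * Real.pi * M * ∫ s, H s ^ 2) / c ^ 2 *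
      (1 / T)) atTop (𝓝 0) := by
    have h := (tendsto_inv_atTop_zero (𝕜 := ℝ)).const_mul
      (4 * Real.pi * M * (2 * Real.pi * M * ∫ s, H s ^ 2) / c ^ 2)
    simpa only [one_div, mul_zero] using h
  -- The bias term depends on `Δ` alone and the variance bound on `T` alone, so the limits combine
  -- along the product filter.
  have hsum := (hbias'.comp (tendsto_snd (f := atTop) (g := atTop))).add
    (hvar.comp (tendsto_fst (f := atTop) (g := atTop)))
  rw [add_zero] at hsum
  refine squeeze_zero' (Eventually.of_forall fun p => integral_nonneg fun ω => by positivity)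
    ?_ hsum
  filter_upwards [tendsto_fst.eventually (eventually_gt_atTop (0 : ℝ)),
    tendsto_snd.eventually (eventually_gt_atTop (0 : ℝ))] with p hp1 hp2
  exact (key p.2 hp2).2.2 c hX.c_pos p.1 hp1 τ
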